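/- Throughout, a model category is a category $\mathcal{M}$ with all small limits and colimits, equipped with three classes of maps (weak equivalences, cofibrations, fibrations), each closed under retracts, such that weak equivalences satisfy the two-out-of-three axiom; cofibrations have the left lifting property with respect to acyclic fibrations, and acyclic cofibrations have it with respect to fibrations; and every map factors (not necessarily functorially) as a cofibration followed by an acyclic fibration and as an acyclic cofibration followed by a fibration. It is proper if every pushout of a weak equivalence along a cofibration, and every pullback of a weak equivalence along a fibration, is a weak equivalence. For a category $\mathcal{C}$, the category $\mathrm{pro}\text{-}\mathcal{C}$ has as objects the diagrams $X\colon I\to\mathcal{C}$ indexed by small cofiltered categories, and $$\mathrm{Hom}_{\mathrm{pro}\text{-}\mathcal{C}}(X,Y)=\lim_s\operatorname{colim}_t \mathrm{Hom}_{\mathcal{C}}(X_t,Y_s).$$ A level representation of a map $f\colon X\to Y$ of $\mathrm{pro}\text{-}\mathcal{C}$ is a natural transformation $\tilde f\colon\tilde X\to\tilde Y$ of diagrams indexed by one small cofiltered category $I$, together with pro-isomorphisms $X\cong\tilde X$ and $Y\cong\tilde Y$ which carry $f$ to the map represented by $\tilde f$. It is cofinite directed if $I$ is a non-empty directed partially ordered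 set in which $\{s: s\le t\}$ is finite for every $t$ (with a map $\tilde X_t\to\tilde X_s$ for $s\le t$). In that case its relative matching map at $t$ is the canonical map $$\tilde X_t\longrightarrow \Big(\lim_{s<t}\tilde X_s\Big)\times_{\lim_{s<t}\tilde Y_s}\tilde Y_t .$$ A map of $\mathrm{pro}\text{-}\mathcal{C}$ belongs essentially levelwise to a class of maps of $\mathcal{C}$ if it has a level representation $\tilde f$ with every $\tilde f_s$ in the class. **Theorem.** Let $\mathcal{C}$ be a proper model category. Define the following classes of maps in $\mathrm{pro}\text{-}\mathcal{C}$: - the strict weak equivalences are the essentially levelwise weak equivalences; - the strict cofibrations are the essentially levelwise cofibrations; - the strict fibrations are the retracts of special fibrations, where a special fibration is a map that has a cofinite directed level representation all of whose relative matching maps are fibrations in $\mathcal{C}$. Then these classes define a proper model structure on $\mathrm{pro}\text{-}\mathcal{C}$; in particular $\mathrm{pro}\text{-}\mathcal{C}$ has all small limits and colimits. -/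

import Mathlib

open CategoryTheory CategoryTheory.Limits HomotopicalAlgebra Opposite

universe v u

/-- A pro-object of `C`: a diagram in `C` indexed by a small cofiltered category. -/
structure ProObject (C : Type u) [Category.{v} C] : Type (max u (v + 1)) where
  /-- the indexing category -/
  Index : Type v
  [smallCategory : SmallCategory Index]
  [isCofiltered : IsCofiltered Index]
  /-- the diagram -/
  diagram : Index ⥤ C

namespace ProObject

attribute [instance] ProObject.smallCategory ProObject.isCofiltered

noncomputable section

variable {C : Type u} [Category.{v} C]

/-- The functor `c ↦ colim_t Hom(X_t, c)` attached to a pro-object `X = (X_t)`. Colimits of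
functors are computed pointwise. -/
def corep (X : ProObject C) : C ⥤ Type v :=
  colimit (X.diagram.op ⋙ coyoneda)

/-- The class in `colim_t Hom(X_t, c)` of a map `f : X_t ⟶ c`. -/
def germ (X : ProObject C) (t : X.Index) {c : C} (f : X.diagram.obj t ⟶ c) : X.corep.obj c :=
  (colimit.ι (X.diagram.op ⋙ coyoneda) (op t)).app c f

/-- Every element of `colim_t Hom(X_t, c)` is represented by some `X_t ⟶ c`. -/
lemma exists_germ (X : ProObject C) {c : C} (x : X.corep.obj c) :
    ∃ (t : X.Index) (f : X.diagram.obj t ⟶ c), X.germ t f = x := by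
  obtain ⟨t, f, h⟩ := Types.jointly_surjective_of_isColimit
    (isColimitOfPreserves ((evaluation C (Type v)).obj c)
      (colimit.isColimit (X.diagram.op ⋙ coyoneda))) x
  exact ⟨t.unop, f, h⟩

lemma germ_map (X : ProObject C) {t t' : X.Index} (a : t' ⟶ t) {c : C}
    (f : X.diagram.obj t ⟶ c) : X.germ t' (X.diagram.map a ≫ f) = X.germ t f := by
  have h := colimit.w (X.diagram.op ⋙ coyoneda) a.op
  exact ConcreteCategory.congr_hom (NatTrans.congr_app h c) f

lemma corep_map_germ (X : ProObject C) (t : X.Index) {c d : C}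
    (f : X.diagram.obj t ⟶ c) (g : c ⟶ d) :
    X.corep.map g (X.germ t f) = X.germ t (f ≫ g) :=
  (NatTrans.naturality_apply (colimit.ι (X.diagram.op ⋙ coyoneda) (op t)) g f).symm

/-- Two maps `X_t ⟶ c` and `X_t' ⟶ c` have the same class in the colimit exactly when they agree
after restriction to some common index. -/
lemma germ_eq_iff (X : ProObject C) {t t' : X.Index} {c : C}
    (f : X.diagram.obj t ⟶ c) (f' : X.diagram.obj t' ⟶ c) :
    X.germ t f = X.germ t' f' ↔ ∃ (r : X.Index) (a : r ⟶ t) (a' : r ⟶ t'),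
      X.diagram.map a ≫ f = X.diagram.map a' ≫ f' := by
  have h := Types.FilteredColimit.isColimit_eq_iff _
    (isColimitOfPreserves ((evaluation C (Type v)).obj c)
      (colimit.isColimit (X.diagram.op ⋙ coyoneda))) (i := op t) (j := op t') (xi := f) (xj := f')
  refine Iff.trans h ⟨?_, ?_⟩
  · rintro ⟨r, a, a', e⟩
    exact ⟨r.unop, a.unop, a'.unop, e⟩
  · rintro ⟨r, a, a', e⟩
    exact ⟨op r, a.op, a'.op, e⟩

/-- Morphisms of pro-objects: elements of `lim_s colim_t Hom(X_t, Y_s)`, that is, families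
`s ↦ x_s` with `x_s` in `colim_t Hom(X_t, Y_s)`, compatible with the transition maps of `Y`. -/
@[ext]
structure Hom (X Y : ProObject C) : Type v where
  /-- the component in `colim_t Hom(X_t, Y_s)` -/
  comp : ∀ s : Y.Index, X.corep.obj (Y.diagram.obj s)
  compatible : ∀ {s s' : Y.Index} (a : s ⟶ s'), X.corep.map (Y.diagram.map a) (comp s) = comp s'

/-- A morphism `X ⟶ Y`, seen as a cocone on the functors `Hom(Y_s, -)`. -/
def Hom.cocone {X Y : ProObject C} (f : Hom X Y) : Cocone (Y.diagram.op ⋙ coyoneda) where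
  pt := X.corep
  ι :=
    { app := fun s ↦ coyonedaEquiv.symm (f.comp s.unop)
      naturality := fun s s' a ↦ by
        have h := coyonedaEquiv_symm_map (Y.diagram.map a.unop) (F := X.corep) (f.comp s'.unop)
        rw [f.compatible a.unop] at h
        refine Eq.trans ?_ (Category.comp_id _).symm
        exact h.symm }

/-- The natural transformation from `colim_s Hom(Y_s, -)` to `colim_t Hom(X_t, -)` given by
precomposition with a morphism `X ⟶ Y`. -/
def Hom.precomp {X Y : ProObject C} (f : Hom X Y) : Y.corep ⟶ X.corep :=
  colimit.desc (Y.diagram.op ⋙ coyoneda) f.cocone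

lemma Hom.precomp_app_germ_id {X Y : ProObject C} (f : Hom X Y) (s : Y.Index) :
    f.precomp.app _ (Y.germ s (𝟙 _)) = f.comp s := by
  have h := NatTrans.congr_app (colimit.ι_desc f.cocone (op s)) (Y.diagram.obj s)
  refine (ConcreteCategory.congr_hom h (𝟙 (Y.diagram.obj s))).trans ?_
  exact coyonedaEquiv.apply_symm_apply (f.comp s)

/-- `lim_s colim_t Hom(X_t, Y_s)` is the set of natural transformations from
`colim_s Hom(Y_s, -)` to `colim_t Hom(X_t, -)`. -/
def homEquiv (X Y : ProObject C) : Hom X Y ≃ (Y.corep ⟶ X.corep) where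
  toFun f := f.precomp
  invFun η :=
    { comp := fun s ↦ η.app _ (Y.germ s (𝟙 _))
      compatible := fun {s s'} a ↦ by
        refine (NatTrans.naturality_apply η (Y.diagram.map a) (Y.germ s (𝟙 _))).symm.trans ?_
        rw [corep_map_germ, Category.id_comp, ← Y.germ_map a (𝟙 _), Category.comp_id] }
  left_inv f := Hom.ext (funext fun s ↦ f.precomp_app_germ_id s)
  right_inv η := by
    refine colimit.hom_ext fun s ↦ ?_
    refine (colimit.ι_desc _ _).trans ?_
    refine coyonedaEquiv.injective ?_
    exact coyonedaEquiv.apply_symm_apply _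

/-- The category of pro-objects of `C`. -/
instance : Category.{v} (ProObject C) where
  Hom := Hom
  id X := (homEquiv X X).symm (𝟙 _)
  comp {X Y Z} f g := (homEquiv X Z).symm (homEquiv Y Z g ≫ homEquiv X Y f)
  id_comp f := by simp
  comp_id f := by simp
  assoc f g h := by simp

@[ext]
lemma hom_ext {X Y : ProObject C} {f g : X ⟶ Y} (h : ∀ s, f.comp s = g.comp s) : f = g :=
  Hom.ext (funext h)

/-- The identity is represented by the identities. -/
lemma id_component (X : ProObject C) (s : X.Index) :
    Hom.comp (𝟙 X) s = X.germ s (𝟙 (X.diagram.obj s)) := rfl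

/-- If `f` is represented at `s` by `a : X_t ⟶ Y_s` and `g` is represented at `r` by
`b : Y_s ⟶ Z_r`, then the composite is represented at `r` by `a ≫ b`. -/
lemma comp_component {X Y Z : ProObject C} (f : X ⟶ Y) (g : Y ⟶ Z) (r : Z.Index) (s : Y.Index)
    (t : X.Index) (a : X.diagram.obj t ⟶ Y.diagram.obj s)
    (b : Y.diagram.obj s ⟶ Z.diagram.obj r) (ha : Hom.comp f s = X.germ t a)
    (hb : Hom.comp g r = Y.germ s b) : Hom.comp (f ≫ g) r = X.germ t (a ≫ b) := by
  have h1 : Hom.comp (f ≫ g) r = (Hom.precomp f).app _ (Hom.comp g r) :=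
    congrArg _ (Hom.precomp_app_germ_id g r)
  have h3 : Y.germ s b = Y.corep.map b (Y.germ s (𝟙 _)) := by
    rw [corep_map_germ, Category.id_comp]
  rw [h1, hb, h3, NatTrans.naturality_apply, Hom.precomp_app_germ_id, ha, corep_map_germ]

/-- The morphism of pro-objects represented by a natural transformation between diagrams with the
same indexing category. -/
def levelMap {I : Type v} [SmallCategory I] [IsCofiltered I] {F G : I ⥤ C} (φ : F ⟶ G) :
    (ProObject.mk I F) ⟶ (ProObject.mk I G) :=
  Hom.mk (fun s ↦ (ProObject.mk I F).germ s (φ.app s)) (fun {s s'} a ↦ by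
    have h := (ProObject.mk I F).corep_map_germ s (φ.app s) (G.map a)
    refine h.trans ?_
    rw [← φ.naturality a]
    exact (ProObject.mk I F).germ_map a (φ.app s'))

/-- The natural transformation `φ` is a level representation of the morphism `f`: there are
isomorphisms of pro-objects identifying `f` with the morphism represented by `φ`. -/
def IsLevelRepresentation {X Y : ProObject C} (f : X ⟶ Y)
    {I : Type v} [SmallCategory I] [IsCofiltered I] {F G : I ⥤ C} (φ : F ⟶ G) : Prop :=
  ∃ (e : X ≅ ProObject.mk I F) (e' : Y ≅ ProObject.mk I G),
    f ≫ e'.hom = e.hom ≫ levelMap φ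

/-- The morphisms of pro-objects that belong to `P` essentially levelwise, that is, that have a
level representation all of whose components belong to `P`. -/
def essentiallyLevelwise (P : MorphismProperty C) : MorphismProperty (ProObject C) :=
  fun _ _ f ↦ ∃ (I : Type v) (_ : SmallCategory I) (_ : IsCofiltered I) (F G : I ⥤ C)
    (φ : F ⟶ G), IsLevelRepresentation f φ ∧ ∀ s : I, P (φ.app s)

section Matching

/- A diagram indexed by a directed set `I`, in which `s ≤ t` gives a map `X_t ⟶ X_s`, is a functor
`Iᵒᵖ ⥤ C`. -/
variable [HasLimits C] {I : Type v} [PartialOrder I]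

/-- The restriction of a diagram to the indices `s < t`. -/
def below (F : Iᵒᵖ ⥤ C) (t : I) : {s : I // s < t}ᵒᵖ ⥤ C :=
  (Subtype.mono_coe (fun s : I ↦ s < t)).functor.op ⋙ F

/-- The cone on `(X_s)_{s < t}` with point `X_t` given by the transition maps. -/
def belowCone (F : Iᵒᵖ ⥤ C) (t : I) : Cone (below F t) where
  pt := F.obj (op t)
  π :=
    { app := fun s ↦ F.map (homOfLE (le_of_lt s.unop.property)).op
      naturality := fun s s' a ↦ by
        refine (Category.id_comp _).trans ?_
        exact F.map_comp (homOfLE (le_of_lt s.unop.property)).op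
          ((Subtype.mono_coe (fun s : I ↦ s < t)).functor.op.map a) }

/-- The object `lim_{s < t} X_s`. -/
def matchingObj (F : Iᵒᵖ ⥤ C) (t : I) : C :=
  limit (below F t)

/-- The canonical map `X_t ⟶ lim_{s < t} X_s`. -/
def matchingProj (F : Iᵒᵖ ⥤ C) (t : I) : F.obj (op t) ⟶ matchingObj F t :=
  limit.lift (below F t) (belowCone F t)

/-- The map `lim_{s < t} X_s ⟶ lim_{s < t} Y_s` induced by a natural transformation. -/
def matchingMap {F G : Iᵒᵖ ⥤ C} (φ : F ⟶ G) (t : I) : matchingObj F t ⟶ matchingObj G t :=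
  limMap (Functor.whiskerLeft (Subtype.mono_coe (fun s : I ↦ s < t)).functor.op φ :
    below F t ⟶ below G t)

/-- The projection `lim_{s < t} X_s ⟶ X_s`. -/
def matchingπ (F : Iᵒᵖ ⥤ C) (t s : I) (h : s < t) : matchingObj F t ⟶ F.obj (op s) :=
  limit.π (below F t) (op ⟨s, h⟩)

lemma matchingObj_hom_ext {F : Iᵒᵖ ⥤ C} {t : I} {Z : C} {f g : Z ⟶ matchingObj F t}
    (w : ∀ (s : I) (h : s < t), f ≫ matchingπ F t s h = g ≫ matchingπ F t s h) : f = g :=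
  limit.hom_ext fun s ↦ w s.unop.1 s.unop.2

lemma matchingProj_π (F : Iᵒᵖ ⥤ C) (t s : I) (h : s < t) :
    matchingProj F t ≫ matchingπ F t s h = F.map (homOfLE h.le).op :=
  limit.lift_π (belowCone F t) _

lemma matchingMap_π {F G : Iᵒᵖ ⥤ C} (φ : F ⟶ G) (t s : I) (h : s < t) :
    matchingMap φ t ≫ matchingπ G t s h = matchingπ F t s h ≫ φ.app (op s) :=
  limMap_π _ _

lemma matchingProj_naturality {F G : Iᵒᵖ ⥤ C} (φ : F ⟶ G) (t : I) :
    matchingProj F t ≫ matchingMap φ t = φ.app (op t) ≫ matchingProj G t := by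
  refine matchingObj_hom_ext fun s h ↦ ?_
  rw [Category.assoc, Category.assoc, matchingMap_π, matchingProj_π, ← Category.assoc,
    matchingProj_π, φ.naturality]

/-- The relative matching map
`X_t ⟶ (lim_{s < t} X_s) ×_{lim_{s < t} Y_s} Y_t`. -/
def relMatchingMap {F G : Iᵒᵖ ⥤ C} (φ : F ⟶ G) (t : I) :
    F.obj (op t) ⟶ pullback (matchingMap φ t) (matchingProj G t) :=
  pullback.lift (matchingProj F t) (φ.app (op t)) (matchingProj_naturality φ t)

end Matching

/-- The special morphisms attached to `P`: those that have a level representation indexed by a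
cofinite directed set, all of whose relative matching maps belong to `P`. -/
def special [HasLimits C] (P : MorphismProperty C) : MorphismProperty (ProObject C) :=
  fun _ _ f ↦ ∃ (I : Type v) (_ : PartialOrder I) (_ : Nonempty I)
    (_ : IsDirected I (fun s t ↦ s ≤ t)) (F G : Iᵒᵖ ⥤ C) (φ : F ⟶ G),
    (∀ t : I, (Set.Iic t).Finite) ∧ IsLevelRepresentation f φ ∧
      ∀ t : I, P (relMatchingMap φ t)

variable (C)

/-- Strict weak equivalences: the essentially levelwise weak equivalences. -/
def strictWeakEquivalences [CategoryWithWeakEquivalences C] : MorphismProperty (ProObject C) :=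
  essentiallyLevelwise (weakEquivalences C)

/-- Strict cofibrations: the essentially levelwise cofibrations. -/
def strictCofibrations [CategoryWithCofibrations C] : MorphismProperty (ProObject C) :=
  essentiallyLevelwise (cofibrations C)

/-- Special fibrations: the morphisms having a cofinite directed level representation whose
relative matching maps are all fibrations. -/
def specialFibrations [HasLimits C] [CategoryWithFibrations C] : MorphismProperty (ProObject C) :=
  special (fibrations C)

/-- Strict fibrations: the retracts of special fibrations. -/
def strictFibrations [HasLimits C] [CategoryWithFibrations C] : MorphismProperty (ProObject C) :=
  (specialFibrations C).retracts

end

end ProObject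

/-- A model category is proper if weak equivalences are stable under pushout along cofibrations
and under pullback along fibrations. -/
structure IsProperModelCategory (M : Type u) [Category.{v} M] [ModelCategory M] : Prop where
  left : ∀ {A B A' B' : M} {i : A ⟶ B} {w : A ⟶ A'} {w' : B ⟶ B'} {i' : A' ⟶ B'},
    IsPushout i w w' i' → cofibrations M i → weakEquivalences M w → weakEquivalences M w'
  right : ∀ {X Y X' Y' : M} {w' : X' ⟶ X} {p' : X' ⟶ Y'} {p : X ⟶ Y} {w : Y' ⟶ Y},
    IsPullback w' p' p w → fibrations M p → weakEquivalences M w → weakEquivalences M w'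

/-!
# The strict model structure on the pro-category of a proper model category

*The criterion.* A morphism `f` of pro-objects belongs essentially levelwise to a class `P` if and
only if every map from `f` to an arrow of `C` factors through an arrow in `P` (`FactorsThrough`,
`essentiallyLevelwise_iff`). For the nontrivial direction, choose such a factorization for each level
of a level representation of `f`; the chosen arrows, with all maps between them under `f`, form a
cofiltered diagram of arrows in `P` whose limit is `f`. The criterion turns statements about strict
weak equivalences and strict cofibrations into diagram chases in `C` with finitely many objects:
stability under retracts is formal, the two-out-of-three property is obtained by making arrows of
`C` into fibrations or cofibrations and using that `C` is proper, and left properness is a cobase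
change. For right properness, a pullback of an essentially levelwise fibration is reindexed to a
levelwise pullback.

*Lifting.* A morphism satisfying the criterion for `L` lifts against constant morphisms in `L.rlp`,
hence, by induction over a cofinite index set, against every special map of `L.rlp`, one relative
matching map at a time (`FactorsThrough.hasLiftingProperty_special`). Here one uses that the
constant pro-object functor preserves finite limits. An acyclic strict cofibration is essentially
levelwise an acyclic cofibration (`factorsThrough_trivialCofibrations`), so it lifts against strict
fibrations. The same induction shows that special fibrations are levelwise fibrations.

*Factorization.* Represent a morphism by a map of diagrams `F ⟶ G` on a cofinite directed set, and
give the indices a strictly monotone rank in `ℕ`. The indices of a given rank form an antichain, and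
the values of a diagram on an antichain can be modified independently
(`exists_factorization_on_antichain`). Doing so for the ranks `0, 1, 2, …` gives a tower of diagrams
between `F` and `G` which at each index is eventually constant. Its diagonal `Z` factors the given
map as a levelwise `L`-map followed by a map whose relative matching maps are in `L.rlp`
(`exists_factorization_relMatchingMap`). The remaining lifting axiom, for acyclic strict fibrations,
follows by the retract argument.

*Limits and colimits.* The pro-category of `C` is opposite to the ind-category of `Cᵒᵖ`, which has
colimits and limits.
-/

/-! ### Cofinite and well-founded posets -/

/-- In a cofinite poset, the number of elements below an element is a strictly monotone rank. -/
lemma exists_strictMono_nat {I : Type v} [PartialOrder I] (h : ∀ t : I, (Set.Iic t).Finite) :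
    ∃ r : I → ℕ, StrictMono r :=
  ⟨fun t ↦ (Set.Iic t).ncard, fun _ t hst ↦
    Set.ncard_lt_ncard (Set.Iic_ssubset_Iic.2 hst) (h t)⟩

/-- A directed poset receives a monotone map from its poset of finite subsets which sends a finite
subset to an upper bound of it. -/
lemma exists_monotone_upperBound {α : Type v} [PartialOrder α] [IsDirected α (· ≤ ·)]
    [Nonempty α] : ∃ m : Finset α → α, Monotone m ∧ ∀ S, ∀ a ∈ S, a ≤ m S := by
  classical
  have key : ∀ (S : Finset α) (g : ∀ T : Finset α, T ⊂ S → α),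
      ∃ b : α, (∀ a ∈ S, a ≤ b) ∧ ∀ T hT, g T hT ≤ b := by
    intro S g
    let A : Finset α := S.ssubsets.attach.image (fun T ↦ g T.1 (Finset.mem_ssubsets.1 T.2))
    obtain ⟨b, hb⟩ := Finset.exists_le (S ∪ A)
    refine ⟨b, fun a ha ↦ hb a (Finset.mem_union_left _ ha), fun T hT ↦ hb _ ?_⟩
    exact Finset.mem_union_right _
      (Finset.mem_image.2 ⟨⟨T, Finset.mem_ssubsets.2 hT⟩, Finset.mem_attach _ _, rfl⟩)
  choose step h1 h2 using key
  let m : Finset α → α := fun S ↦ Finset.strongInduction step S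
  have hm : ∀ S, m S = step S (fun T _ ↦ m T) := fun S ↦ Finset.strongInduction_eq step S
  refine ⟨m, fun T S hTS ↦ ?_, fun S a ha ↦ ?_⟩
  · rcases eq_or_ssubset_of_subset hTS with rfl | h
    · exact le_rfl
    · rw [hm S]
      exact h2 S (fun T _ ↦ m T) T h
  · rw [hm S]
    exact h1 S _ a ha

/-- Every small cofiltered category receives an initial functor from the opposite of a cofinite
directed set. -/
lemma exists_cofinite_initial (J : Type v) [SmallCategory J] [IsCofiltered J] :
    ∃ (I : Type v) (_ : PartialOrder I) (_ : Nonempty I) (_ : IsDirected I (fun s t ↦ s ≤ t))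
      (ρ : Iᵒᵖ ⥤ J), ρ.Initial ∧ ∀ t : I, (Set.Iic t).Finite := by
  classical
  obtain ⟨α, _, _, _, F, hF⟩ := IsFiltered.exists_directed Jᵒᵖ
  obtain ⟨m, hm, hm'⟩ := exists_monotone_upperBound (α := α)
  have hfin : hm.functor.Final := by
    rw [Functor.final_iff_of_isFiltered]
    refine ⟨fun a ↦ ⟨{a}, ⟨homOfLE (hm' _ _ (Finset.mem_singleton_self a))⟩⟩, fun {a S} _ _ ↦
      ⟨S, 𝟙 S, Subsingleton.elim _ _⟩⟩
  refine ⟨Finset α, inferInstance, inferInstance, inferInstance, (hm.functor ⋙ F).leftOp,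
    inferInstance, fun S ↦ ?_⟩
  exact S.powerset.finite_toSet.subset fun T hT ↦ Finset.mem_coe.2 (Finset.mem_powerset.2 hT)

/-- On a well-founded poset, a system of types in which every compatible family below an index
extends to that index has a compatible family. -/
lemma exists_compatible_family {I : Type*} [PartialOrder I] [WellFoundedLT I] (S : I → Type*)
    (ρ : ∀ {s t : I}, s ≤ t → S t → S s) (hid : ∀ (t : I) (x : S t), ρ le_rfl x = x)
    (ext : ∀ (t : I) (x : ∀ s, s < t → S s),
      (∀ (r s : I) (hr : r ≤ s) (hs : s < t), ρ hr (x s hs) = x r (hr.trans_lt hs)) →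
      ∃ y : S t, ∀ (s : I) (hs : s < t), ρ hs.le y = x s hs) :
    ∃ x : ∀ t, S t, ∀ {s t : I} (h : s ≤ t), ρ h (x t) = x s := by
  classical
  -- the family is built by recursion, with value `none` where the choices made below do not extend
  let step (t : I) (x : ∀ s, s < t → Option (S s)) : Option (S t) :=
    if h : ∃ y : S t, ∀ s hs, x s hs = some (ρ (le_of_lt hs) y) then some h.choose else none
  let X : ∀ t, Option (S t) := wellFounded_lt.fix step
  have hX : ∀ t, X t = step t (fun s _ ↦ X s) := fun t ↦ wellFounded_lt.fix_eq step t
  have key : ∀ t, ∃ y, X t = some y ∧ ∀ s (h : s ≤ t), X s = some (ρ h y) := by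
    intro t
    induction t using WellFoundedLT.induction with
    | ind t ih =>
      choose y hy hy' using ih
      obtain ⟨z, hz⟩ := ext t y fun r s hr hs ↦
        Option.some_injective _ ((hy' s hs r hr).symm.trans (hy r (hr.trans_lt hs)))
      have h : ∃ y : S t, ∀ s (hs : s < t), X s = some (ρ (le_of_lt hs) y) :=
        ⟨z, fun s hs ↦ by rw [hz s hs, hy s hs]⟩
      have ht : X t = some h.choose := by rw [hX]; exact dif_pos h
      refine ⟨_, ht, fun s hs ↦ ?_⟩
      rcases hs.lt_or_eq with hs' | rfl
      · exact h.choose_spec s hs'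
      · rw [ht, hid]
  choose x hx hx' using key
  exact ⟨x, fun {s t} h ↦ Option.some_injective _ ((hx' t s h).symm.trans (hx s))⟩

namespace ProObject

noncomputable section

variable {C : Type u} [Category.{v} C]

/-! ### Constant pro-objects -/

lemma levelMap_comp_eq {I : Type v} [SmallCategory I] [IsCofiltered I] {F G H : I ⥤ C}
    (φ : F ⟶ G) (ψ : G ⟶ H) : levelMap φ ≫ levelMap ψ = levelMap (φ ≫ ψ) :=
  hom_ext fun s ↦ comp_component (levelMap φ) (levelMap ψ) s s s (φ.app s) (ψ.app s) rfl rfl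

/-- The embedding of `C` into its pro-category by the constant pro-objects, indexed by the
category with one morphism. -/
def constant : C ⥤ ProObject C where
  obj c := ProObject.mk (Discrete PUnit) ((Functor.const _).obj c)
  map f := levelMap ((Functor.const _).map f)
  map_id _ := rfl
  map_comp f g := (levelMap_comp_eq ((Functor.const _).map f) ((Functor.const _).map g)).symm

/-- The morphism `X ⟶ c` to a constant pro-object given by an element of
`colim_t Hom(X_t, c)`. -/
def ofCorep {X : ProObject C} {c : C} (x : X.corep.obj c) : X ⟶ constant.obj c :=
  Hom.mk (fun _ ↦ x) (fun _ ↦ by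
    change X.corep.map (𝟙 c) x = x
    simp)

lemma ofCorep_surjective {X : ProObject C} {c : C} (x : X ⟶ constant.obj c) :
    ∃ y : X.corep.obj c, ofCorep y = x :=
  ⟨Hom.comp x ⟨⟨⟩⟩, hom_ext fun ⟨⟨⟩⟩ ↦ rfl⟩

lemma ofCorep_injective {X : ProObject C} {c : C} {x y : X.corep.obj c}
    (h : ofCorep x = ofCorep y) : x = y :=
  congrArg (fun f : X ⟶ constant.obj c ↦ Hom.comp f ⟨⟨⟩⟩) h

/-- The projection from a pro-object to its term of index `t`. -/
def proj (X : ProObject C) (t : X.Index) : X ⟶ constant.obj (X.diagram.obj t) :=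
  ofCorep (X.germ t (𝟙 _))

lemma proj_comp_map (X : ProObject C) (t : X.Index) {c : C} (f : X.diagram.obj t ⟶ c) :
    X.proj t ≫ constant.map f = ofCorep (X.germ t f) := by
  refine hom_ext fun s ↦ ?_
  refine (comp_component (X.proj t) (constant.map f) s s t (𝟙 _) f rfl rfl).trans ?_
  exact congrArg (X.germ t) (Category.id_comp f)

lemma exists_eq_proj_comp {X : ProObject C} {c : C} (x : X ⟶ constant.obj c) :
    ∃ (t : X.Index) (f : X.diagram.obj t ⟶ c), x = X.proj t ≫ constant.map f := by
  obtain ⟨y, rfl⟩ := ofCorep_surjective x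
  obtain ⟨t, f, rfl⟩ := X.exists_germ y
  exact ⟨t, f, (X.proj_comp_map t f).symm⟩

lemma proj_comp_map_eq_iff (X : ProObject C) {t t' : X.Index} {c : C}
    (f : X.diagram.obj t ⟶ c) (f' : X.diagram.obj t' ⟶ c) :
    X.proj t ≫ constant.map f = X.proj t' ≫ constant.map f' ↔
      ∃ (r : X.Index) (a : r ⟶ t) (a' : r ⟶ t'),
        X.diagram.map a ≫ f = X.diagram.map a' ≫ f' := by
  rw [proj_comp_map, proj_comp_map, ← germ_eq_iff]
  exact ⟨ofCorep_injective, fun h ↦ by rw [h]⟩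

/-- Two maps out of the same term of a cofiltered diagram that agree on the pro-object agree after
one transition map. -/
lemma exists_map_comp_eq (X : ProObject C) {t : X.Index} {c : C}
    (f f' : X.diagram.obj t ⟶ c)
    (h : X.proj t ≫ constant.map f = X.proj t ≫ constant.map f') :
    ∃ (r : X.Index) (a : r ⟶ t), X.diagram.map a ≫ f = X.diagram.map a ≫ f' := by
  obtain ⟨r, a, a', e⟩ := (X.proj_comp_map_eq_iff f f').1 h
  refine ⟨IsCofiltered.eq a a', IsCofiltered.eqHom a a' ≫ a, ?_⟩
  have h2 : IsCofiltered.eqHom a a' ≫ a = IsCofiltered.eqHom a a' ≫ a' :=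
    IsCofiltered.eq_condition a a'
  conv_rhs => rw [h2]
  rw [Functor.map_comp, Functor.map_comp, Category.assoc, Category.assoc, e]

@[simp]
lemma proj_map (X : ProObject C) {t t' : X.Index} (a : t' ⟶ t) :
    X.proj t' ≫ constant.map (X.diagram.map a) = X.proj t := by
  rw [proj_comp_map, ← Category.comp_id (X.diagram.map a), germ_map]
  rfl

@[simp]
lemma proj_map_assoc (X : ProObject C) {t t' : X.Index} (a : t' ⟶ t) {Z : ProObject C}
    (h : constant.obj (X.diagram.obj t) ⟶ Z) :
    X.proj t' ≫ constant.map (X.diagram.map a) ≫ h = X.proj t ≫ h := by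
  rw [← Category.assoc, proj_map]

lemma comp_proj {W X : ProObject C} (f : W ⟶ X) (s : X.Index) :
    f ≫ X.proj s = ofCorep (Hom.comp f s) := by
  refine hom_ext fun r ↦ ?_
  obtain ⟨t, a, ha⟩ := W.exists_germ (Hom.comp f s)
  refine (comp_component f (X.proj s) r s t a (𝟙 _) ha.symm rfl).trans ?_
  exact (congrArg (W.germ t) (Category.comp_id a)).trans ha

/-- A pro-object is the limit of its terms: uniqueness of the morphism to it. -/
lemma hom_ext_proj {W X : ProObject C} {f g : W ⟶ X}
    (h : ∀ s, f ≫ X.proj s = g ≫ X.proj s) : f = g :=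
  hom_ext fun s ↦ ofCorep_injective (by rw [← comp_proj, ← comp_proj, h])

lemma ofCorep_comp_map {X : ProObject C} {c d : C} (x : X.corep.obj c) (f : c ⟶ d) :
    ofCorep x ≫ constant.map f = ofCorep (X.corep.map f x) := by
  obtain ⟨t, g, rfl⟩ := X.exists_germ x
  rw [corep_map_germ, ← proj_comp_map, ← proj_comp_map, Functor.map_comp, Category.assoc]

/-- A pro-object is the limit of its terms: existence of the morphism to it. -/
lemma exists_lift {W : ProObject C} (X : ProObject C)
    (x : ∀ s : X.Index, W ⟶ constant.obj (X.diagram.obj s))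
    (hx : ∀ {s s' : X.Index} (a : s ⟶ s'), x s ≫ constant.map (X.diagram.map a) = x s') :
    ∃ f : W ⟶ X, ∀ s, f ≫ X.proj s = x s := by
  choose y hy using fun s ↦ ofCorep_surjective (x s)
  refine ⟨Hom.mk y fun {s s'} a ↦ ofCorep_injective ?_, fun s ↦ ?_⟩
  · rw [← ofCorep_comp_map, hy, hy, hx]
  · rw [comp_proj]
    exact hy s

@[simp]
lemma levelMap_proj {I : Type v} [SmallCategory I] [IsCofiltered I] {F G : I ⥤ C} (φ : F ⟶ G)
    (s : I) : levelMap φ ≫ (ProObject.mk I G).proj s =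
      (ProObject.mk I F).proj s ≫ constant.map (φ.app s) := by
  rw [comp_proj, proj_comp_map]
  rfl

/-- A morphism of pro-objects is an isomorphism as soon as it induces bijections on morphisms to
the constant pro-objects. -/
lemma isIso_of_bijective {X Y : ProObject C} (g : X ⟶ Y)
    (h : ∀ c : C, Function.Bijective (fun y : Y ⟶ constant.obj c ↦ g ≫ y)) : IsIso g := by
  choose x hx using fun s ↦ (h (X.diagram.obj s)).2 (X.proj s)
  dsimp only at hx
  obtain ⟨k, hk⟩ := exists_lift X x (fun {s s'} a ↦ (h _).1 (by
    dsimp only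
    rw [← Category.assoc, hx, hx, proj_map]))
  have h1 : g ≫ k = 𝟙 X := hom_ext_proj fun s ↦ by
    rw [Category.assoc, hk, hx, Category.id_comp]
  refine ⟨k, h1, hom_ext_proj fun s ↦ (h _).1 ?_⟩
  dsimp only
  rw [Category.id_comp, Category.assoc, ← Category.assoc g k, h1, Category.id_comp]

/-- A compatible family of maps from `X` to the terms of a cofiltered diagram exhibits `X` as the
pro-object of that diagram if every map from `X` to an object of `C` factors through a term,
essentially uniquely. -/
lemma exists_iso_of_cone {X : ProObject C} {J : Type v} [SmallCategory J] [IsCofiltered J]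
    (D : J ⥤ C) (x : ∀ j, X ⟶ constant.obj (D.obj j))
    (hx : ∀ {j j' : J} (a : j ⟶ j'), x j ≫ constant.map (D.map a) = x j')
    (h1 : ∀ {c : C} (y : X ⟶ constant.obj c), ∃ (j : J) (f : D.obj j ⟶ c),
      x j ≫ constant.map f = y)
    (h2 : ∀ {c : C} (j : J) (f f' : D.obj j ⟶ c), x j ≫ constant.map f = x j ≫ constant.map f' →
      ∃ (r : J) (a : r ⟶ j), D.map a ≫ f = D.map a ≫ f') :
    ∃ e : X ≅ ProObject.mk J D, ∀ j, e.hom ≫ (ProObject.mk J D).proj j = x j := by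
  obtain ⟨k, hk⟩ := exists_lift (ProObject.mk J D) x hx
  have : IsIso k := isIso_of_bijective k fun c ↦ by
    constructor
    · intro y y' hy
      dsimp only at hy
      obtain ⟨j, f, rfl⟩ := exists_eq_proj_comp y
      obtain ⟨j', f', rfl⟩ := exists_eq_proj_comp y'
      let a : IsCofiltered.min j j' ⟶ j := IsCofiltered.minToLeft j j'
      let a' : IsCofiltered.min j j' ⟶ j' := IsCofiltered.minToRight j j'
      rw [← proj_map _ a, ← proj_map _ a', Category.assoc, Category.assoc,
        ← Functor.map_comp, ← Functor.map_comp] at hy ⊢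
      rw [← Category.assoc, ← Category.assoc, hk] at hy
      obtain ⟨r, b, e⟩ := h2 _ _ _ hy
      rw [proj_comp_map_eq_iff]
      exact ⟨r, b, b, e⟩
    · intro y
      obtain ⟨j, f, rfl⟩ := h1 y
      exact ⟨(ProObject.mk J D).proj j ≫ constant.map f, by
        dsimp only
        rw [← Category.assoc, hk]⟩
  exact ⟨asIso k, hk⟩

/-- Reindexing a pro-object along an initial functor. -/
lemma exists_iso_of_initial {I : Type v} [SmallCategory I] [IsCofiltered I] (F : I ⥤ C)
    {J : Type v} [SmallCategory J] [IsCofiltered J] (ρ : J ⥤ I) [ρ.Initial] :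
    ∃ e : ProObject.mk I F ≅ ProObject.mk J (ρ ⋙ F),
      ∀ j, e.hom ≫ (ProObject.mk J (ρ ⋙ F)).proj j = (ProObject.mk I F).proj (ρ.obj j) := by
  have hρ := (Functor.initial_iff_of_isCofiltered ρ).1 inferInstance
  refine exists_iso_of_cone (ρ ⋙ F) (fun j ↦ (ProObject.mk I F).proj (ρ.obj j))
    (fun {j j'} a ↦ (ProObject.mk I F).proj_map (ρ.map a)) ?_ ?_
  · intro c y
    obtain ⟨i, f, rfl⟩ := exists_eq_proj_comp y
    obtain ⟨j, ⟨a⟩⟩ := hρ.1 i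
    refine ⟨j, F.map a ≫ f, ?_⟩
    rw [Functor.map_comp, ← Category.assoc]
    congr 1
    exact (ProObject.mk I F).proj_map a
  · intro c j f f' hf
    obtain ⟨i, a, e⟩ := exists_map_comp_eq (ProObject.mk I F) f f' hf
    obtain ⟨j', ⟨b⟩⟩ := hρ.1 i
    obtain ⟨r, d, hd⟩ := hρ.2 (ρ.map (IsCofiltered.minToLeft j' j) ≫ b ≫ a)
      (ρ.map (IsCofiltered.minToRight j' j))
    refine ⟨r, d ≫ IsCofiltered.minToRight j' j, ?_⟩
    have h3 : (ρ ⋙ F).map (d ≫ IsCofiltered.minToRight j' j) =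
        F.map (ρ.map d ≫ ρ.map (IsCofiltered.minToLeft j' j) ≫ b) ≫ F.map a := by
      rw [← F.map_comp, Category.assoc, Category.assoc, hd]
      simp
    rw [h3, Category.assoc, Category.assoc]
    exact congrArg _ e

/-! ### Level representations -/

/-- The functor sending an index `t` of `X` to the projection `X ⟶ X_t`. -/
def projFunctor (X : ProObject C) : X.Index ⥤ StructuredArrow X (constant (C := C)) where
  obj t := StructuredArrow.mk (X.proj t)
  map a := StructuredArrow.homMk (X.diagram.map a) (X.proj_map a)

instance (X : ProObject C) : X.projFunctor.Initial := by
  rw [Functor.initial_iff_of_isCofiltered]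
  refine ⟨fun d ↦ ?_, fun {d t} f f' ↦ ?_⟩
  · obtain ⟨t, f, hf⟩ := exists_eq_proj_comp d.hom
    exact ⟨t, ⟨StructuredArrow.homMk f hf.symm⟩⟩
  · obtain ⟨r, a, h⟩ := X.exists_map_comp_eq f.right f'.right
      ((StructuredArrow.w f).trans (StructuredArrow.w f').symm)
    exact ⟨r, a, StructuredArrow.ext _ _ h⟩

/-- A morphism `w : Y' ⟶ Y` becomes levelwise after reindexing the given diagram of `Y`. -/
lemma exists_level_map {Y' : ProObject C} {I : Type v} [SmallCategory I] [IsCofiltered I]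
    {G : I ⥤ C} (w : Y' ⟶ ProObject.mk I G) :
    ∃ (J : Type v) (_ : SmallCategory J) (_ : IsCofiltered J) (ρ : J ⥤ I) (H : J ⥤ C)
      (ψ : H ⟶ ρ ⋙ G) (e : Y' ≅ ProObject.mk J H)
      (e' : ProObject.mk I G ≅ ProObject.mk J (ρ ⋙ G)), ρ.Initial ∧
      (∀ j, e'.hom ≫ (ProObject.mk J (ρ ⋙ G)).proj j = (ProObject.mk I G).proj (ρ.obj j)) ∧
      w ≫ e'.hom = e.hom ≫ levelMap ψ := by
  let R : I ⥤ StructuredArrow Y' (constant (C := C)) :=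
    { obj i := StructuredArrow.mk (w ≫ (ProObject.mk I G).proj i)
      map a := StructuredArrow.homMk (G.map a) (by
        refine (Category.assoc _ _ _).trans ?_
        exact congrArg (w ≫ ·) ((ProObject.mk I G).proj_map a)) }
  have hJ : IsCofiltered (Comma Y'.projFunctor R) := Comma.isCofiltered_of_initial _ _
  let ρ := Comma.snd Y'.projFunctor R
  let H := Comma.fst Y'.projFunctor R ⋙ Y'.diagram
  let ψ : H ⟶ ρ ⋙ G :=
    { app j := j.hom.right
      naturality j j' a := (congrArg CommaMorphism.right a.w) }
  obtain ⟨e, he⟩ := exists_iso_of_initial Y'.diagram (Comma.fst Y'.projFunctor R)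
  obtain ⟨e', he'⟩ := exists_iso_of_initial G ρ
  refine ⟨_, _, hJ, ρ, H, ψ, e, e', inferInstance, he', hom_ext_proj fun j ↦ ?_⟩
  rw [Category.assoc, Category.assoc, he', levelMap_proj, ← Category.assoc, he]
  exact (StructuredArrow.w j.hom).symm

/-- A level representation can be reindexed along an initial functor. -/
lemma IsLevelRepresentation.reindex {X Y : ProObject C} {f : X ⟶ Y} {I : Type v}
    [SmallCategory I] [IsCofiltered I] {F G : I ⥤ C} {φ : F ⟶ G}
    (h : IsLevelRepresentation f φ) {J : Type v} [SmallCategory J] [IsCofiltered J] (ρ : J ⥤ I)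
    [ρ.Initial] : IsLevelRepresentation f (Functor.whiskerLeft ρ φ) := by
  obtain ⟨e, e', h⟩ := h
  obtain ⟨a, ha⟩ := exists_iso_of_initial F ρ
  obtain ⟨b, hb⟩ := exists_iso_of_initial G ρ
  refine ⟨e ≪≫ a, e' ≪≫ b, ?_⟩
  rw [Iso.trans_hom, Iso.trans_hom, ← Category.assoc, h, Category.assoc, Category.assoc]
  congr 1
  refine hom_ext_proj fun j ↦ ?_
  rw [Category.assoc, Category.assoc, levelMap_proj, hb, levelMap_proj, ← Category.assoc, ha]
  rfl

/-- Every morphism of pro-objects has a cofinite directed level representation. -/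
lemma exists_cofinite_levelRepresentation {X Y : ProObject C} (f : X ⟶ Y) :
    ∃ (I : Type v) (_ : PartialOrder I) (_ : Nonempty I)
      (_ : IsDirected I (fun s t ↦ s ≤ t)) (F G : Iᵒᵖ ⥤ C) (φ : F ⟶ G),
      (∀ t : I, (Set.Iic t).Finite) ∧ IsLevelRepresentation f φ := by
  obtain ⟨J, _, _, ρ, H, ψ, e, e', _, -, h⟩ := exists_level_map (G := Y.diagram) f
  obtain ⟨I, _, _, _, σ, _, hI⟩ := exists_cofinite_initial J
  exact ⟨I, _, ‹_›, ‹_›, _, _, Functor.whiskerLeft σ ψ, hI,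
    IsLevelRepresentation.reindex (φ := ψ) ⟨e, e', h⟩ σ⟩

/-! ### A criterion for belonging essentially levelwise to a class -/

/-- The factorization criterion for `P`: every map from `f` to an arrow of `C` (seen as an arrow
between constant pro-objects) factors through an arrow that belongs to `P`. -/
def FactorsThrough (P : MorphismProperty C) {X Y : ProObject C} (f : X ⟶ Y) : Prop :=
  ∀ {c₀ c₁ : C} (k : c₀ ⟶ c₁) (x : X ⟶ constant.obj c₀) (y : Y ⟶ constant.obj c₁),
    x ≫ constant.map k = f ≫ y →
    ∃ (d₀ d₁ : C) (w : d₀ ⟶ d₁) (x' : X ⟶ constant.obj d₀) (y' : Y ⟶ constant.obj d₁)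
      (a : d₀ ⟶ c₀) (b : d₁ ⟶ c₁), P w ∧ x' ≫ constant.map w = f ≫ y' ∧ w ≫ b = a ≫ k ∧
      x' ≫ constant.map a = x ∧ y' ≫ constant.map b = y

/-- A square from a levelwise map to an arrow of `C` factors through one of the levels. -/
lemma exists_level_factorization {I : Type v} [SmallCategory I] [IsCofiltered I] {F G : I ⥤ C}
    (φ : F ⟶ G) {c₀ c₁ : C} (k : c₀ ⟶ c₁) (x : ProObject.mk I F ⟶ constant.obj c₀)
    (y : ProObject.mk I G ⟶ constant.obj c₁) (h : x ≫ constant.map k = levelMap φ ≫ y) :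
    ∃ (s : I) (a : F.obj s ⟶ c₀) (b : G.obj s ⟶ c₁), φ.app s ≫ b = a ≫ k ∧
      (ProObject.mk I F).proj s ≫ constant.map a = x ∧
      (ProObject.mk I G).proj s ≫ constant.map b = y := by
  obtain ⟨t, a, rfl⟩ := exists_eq_proj_comp x
  obtain ⟨t', b, rfl⟩ := exists_eq_proj_comp y
  rw [← Category.assoc (levelMap φ), levelMap_proj, Category.assoc, Category.assoc,
    ← Functor.map_comp, ← Functor.map_comp, proj_comp_map_eq_iff] at h
  obtain ⟨r, α, β, h⟩ := h
  dsimp only at α β h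
  refine ⟨r, F.map α ≫ a, G.map β ≫ b, ?_, ?_, ?_⟩
  · rw [Category.assoc, h, ← Category.assoc, ← φ.naturality, Category.assoc]
  · rw [Functor.map_comp]
    exact (ProObject.mk I F).proj_map_assoc α _
  · rw [Functor.map_comp]
    exact (ProObject.mk I G).proj_map_assoc β _

lemma FactorsThrough.of_retract {P : MorphismProperty C} {X Y X' Y' : ProObject C}
    {f : X ⟶ Y} {f' : X' ⟶ Y'} (i : X ⟶ X') (j : Y ⟶ Y') (i' : X' ⟶ X) (j' : Y' ⟶ Y)
    (w : f ≫ j = i ≫ f') (w' : f' ≫ j' = i' ≫ f) (hi : i ≫ i' = 𝟙 X) (hj : j ≫ j' = 𝟙 Y)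
    (h : FactorsThrough P f') : FactorsThrough P f := by
  intro c₀ c₁ k x y e
  obtain ⟨d₀, d₁, m, x', y', a, b, hm, h1, h2, h3, h4⟩ := h k (i' ≫ x) (j' ≫ y) (by
    rw [Category.assoc, e, ← Category.assoc, ← w', Category.assoc])
  refine ⟨d₀, d₁, m, i ≫ x', j ≫ y', a, b, hm, ?_, h2, ?_, ?_⟩
  · rw [Category.assoc, h1, ← Category.assoc, ← w, Category.assoc]
  · rw [Category.assoc, h3, ← Category.assoc, hi, Category.id_comp]
  · rw [Category.assoc, h4, ← Category.assoc, hj, Category.id_comp]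

/-- A map from a pro-object to an object of `C` factors through a term of the diagram, so a levelwise
`P`-map satisfies the criterion. -/
lemma factorsThrough_of_essentiallyLevelwise {P : MorphismProperty C} {X Y : ProObject C}
    {f : X ⟶ Y} (h : essentiallyLevelwise P f) : FactorsThrough P f := by
  obtain ⟨I, _, _, F, G, φ, ⟨e, e', h⟩, hφ⟩ := h
  refine FactorsThrough.of_retract (f' := levelMap φ) e.hom e'.hom e.inv e'.inv h ?_
    e.hom_inv_id e'.hom_inv_id ?_
  · rw [Iso.comp_inv_eq, Category.assoc, h, Iso.inv_hom_id_assoc]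
  · intro c₀ c₁ k x y hxy
    obtain ⟨s, a, b, h1, h2, h3⟩ := exists_level_factorization φ k x y hxy
    exact ⟨_, _, φ.app s, _, _, a, b, hφ s, (levelMap_proj φ s).symm, h1, h2, h3⟩

lemma underArrow_w_left {X Y : ProObject C} {f : X ⟶ Y}
    {A B : StructuredArrow (Arrow.mk f) (constant (C := C)).mapArrow} (m : A ⟶ B) :
    A.hom.left ≫ constant.map m.right.left = B.hom.left :=
  congrArg CommaMorphism.left (StructuredArrow.w m)

lemma underArrow_w_right {X Y : ProObject C} {f : X ⟶ Y}
    {A B : StructuredArrow (Arrow.mk f) (constant (C := C)).mapArrow} (m : A ⟶ B) :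
    A.hom.right ≫ constant.map m.right.right = B.hom.right :=
  congrArg CommaMorphism.right (StructuredArrow.w m)

/-- The criterion: a morphism belongs essentially levelwise to `P` as soon as every map from it to
an arrow of `C` factors through an arrow of `P`. The new indexing category consists of one
factorization through `P` for each index of a level representation of `f`, with all morphisms of
arrows under `f` between them. -/
lemma essentiallyLevelwise_of_factorsThrough {P : MorphismProperty C} {X Y : ProObject C}
    {f : X ⟶ Y} (h : FactorsThrough P f) : essentiallyLevelwise P f := by
  obtain ⟨I, _, _, _, F, G, φ, -, ⟨e, e', he⟩⟩ := exists_cofinite_levelRepresentation f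
  let x₀ : ∀ s, X ⟶ constant.obj (F.obj s) := fun s ↦ e.hom ≫ (ProObject.mk _ F).proj s
  let y₀ : ∀ s, Y ⟶ constant.obj (G.obj s) := fun s ↦ e'.hom ≫ (ProObject.mk _ G).proj s
  have hxy : ∀ s, x₀ s ≫ constant.map (φ.app s) = f ≫ y₀ s := fun s ↦ by
    dsimp only [x₀, y₀]
    rw [← Category.assoc, he, Category.assoc, Category.assoc, levelMap_proj]
  have lev : ∀ {c₀ c₁ : C} (k : c₀ ⟶ c₁) (x : X ⟶ constant.obj c₀) (y : Y ⟶ constant.obj c₁),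
      x ≫ constant.map k = f ≫ y → ∃ (s : Iᵒᵖ) (a : F.obj s ⟶ c₀) (b : G.obj s ⟶ c₁),
        φ.app s ≫ b = a ≫ k ∧ x₀ s ≫ constant.map a = x ∧ y₀ s ≫ constant.map b = y := by
    intro c₀ c₁ k x y hk
    obtain ⟨s, a, b, h1, h2, h3⟩ := exists_level_factorization φ k (e.inv ≫ x) (e'.inv ≫ y) (by
      rw [Category.assoc, hk, Iso.inv_comp_eq, ← Category.assoc, ← Category.assoc, ← he]
      simp)
    refine ⟨s, a, b, h1, ?_, ?_⟩
    · dsimp only [x₀]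
      rw [Category.assoc, h2, Iso.hom_inv_id_assoc]
    · dsimp only [y₀]
      rw [Category.assoc, h3, Iso.hom_inv_id_assoc]
  choose d₀ d₁ w x' y' a b hw h1 h2 h3 h4 using fun s ↦ h (φ.app s) (x₀ s) (y₀ s) (hxy s)
  -- the projections to the terms of the level representation form cofiltered limit cones
  have hx₀ : ∀ {s s' : Iᵒᵖ} (α : s ⟶ s'), x₀ s ≫ constant.map (F.map α) = x₀ s' := fun α ↦ by
    dsimp only [x₀]
    rw [Category.assoc]
    exact congrArg (e.hom ≫ ·) ((ProObject.mk _ F).proj_map α)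
  have hy₀ : ∀ {s s' : Iᵒᵖ} (α : s ⟶ s'), y₀ s ≫ constant.map (G.map α) = y₀ s' := fun α ↦ by
    dsimp only [y₀]
    rw [Category.assoc]
    exact congrArg (e'.hom ≫ ·) ((ProObject.mk _ G).proj_map α)
  have ex : ∀ {c : C} {s : Iᵒᵖ} (m m' : F.obj s ⟶ c),
      x₀ s ≫ constant.map m = x₀ s ≫ constant.map m' →
      ∃ (r : Iᵒᵖ) (α : r ⟶ s), F.map α ≫ m = F.map α ≫ m' := by
    intro c s m m' hm
    refine exists_map_comp_eq (ProObject.mk _ F) m m' ((cancel_epi e.hom).1 ?_)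
    exact (Category.assoc _ _ _).symm.trans (hm.trans (Category.assoc _ _ _))
  have ey : ∀ {c : C} {s : Iᵒᵖ} (m m' : G.obj s ⟶ c),
      y₀ s ≫ constant.map m = y₀ s ≫ constant.map m' →
      ∃ (r : Iᵒᵖ) (α : r ⟶ s), G.map α ≫ m = G.map α ≫ m' := by
    intro c s m m' hm
    refine exists_map_comp_eq (ProObject.mk _ G) m m' ((cancel_epi e'.hom).1 ?_)
    exact (Category.assoc _ _ _).symm.trans (hm.trans (Category.assoc _ _ _))
  choose τ p q hpq hp hq using fun s ↦ lev (w s) (x' s) (y' s) (h1 s)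
  let g : Iᵒᵖ → StructuredArrow (Arrow.mk f) (constant (C := C)).mapArrow := fun s ↦
    StructuredArrow.mk (Y := Arrow.mk (w s)) (Arrow.homMk (x' s) (y' s) (h1 s))
  let J := InducedCategory _ g
  let D : J ⥤ Arrow C := inducedFunctor g ⋙ StructuredArrow.proj _ _
  have hDx : ∀ {s s' : J} (m : s ⟶ s'), x' s ≫ constant.map (D.map m).left = x' s' := fun m ↦
    underArrow_w_left m.hom
  have hDy : ∀ {s s' : J} (m : s ⟶ s'), y' s ≫ constant.map (D.map m).right = y' s' := fun m ↦
    underArrow_w_right m.hom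
  -- every transition map `r ⟶ τ s` yields a morphism from the factorization at `r` to that at `s`
  have mor : ∀ {r s : Iᵒᵖ} (α : r ⟶ τ s), ∃ m : (show J from r) ⟶ (show J from s),
      (D.map m).left = a r ≫ F.map α ≫ p s ∧ (D.map m).right = b r ≫ G.map α ≫ q s := by
    intro r s α
    refine ⟨⟨StructuredArrow.homMk (Arrow.homMk (u := a r ≫ F.map α ≫ p s)
      (v := b r ≫ G.map α ≫ q s) ?_) ?_⟩, rfl, rfl⟩
    · change (a r ≫ F.map α ≫ p s) ≫ w s = w r ≫ b r ≫ G.map α ≫ q s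
      rw [← Category.assoc (w r), h2, Category.assoc, Category.assoc, Category.assoc, ← hpq,
        ← Category.assoc (F.map α), φ.naturality, Category.assoc]
    · refine Arrow.hom_ext _ _ ?_ ?_
      · change x' r ≫ constant.map (a r ≫ F.map α ≫ p s) = x' s
        rw [Functor.map_comp, Functor.map_comp, ← Category.assoc, h3, ← Category.assoc, hx₀, hp]
      · change y' r ≫ constant.map (b r ≫ G.map α ≫ q s) = y' s
        rw [Functor.map_comp, Functor.map_comp, ← Category.assoc, h4, ← Category.assoc, hy₀, hq]
  have eqx : ∀ {c : C} {s : J} (m m' : d₀ s ⟶ c),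
      x' s ≫ constant.map m = x' s ≫ constant.map m' →
      ∃ (r : Iᵒᵖ) (α : r ⟶ τ s), ∀ {r' : Iᵒᵖ} (β : r' ⟶ r),
        F.map (β ≫ α) ≫ p s ≫ m = F.map (β ≫ α) ≫ p s ≫ m' := by
    intro c s m m' hm
    obtain ⟨r, α, hα⟩ := ex (p s ≫ m) (p s ≫ m') (by
      rw [Functor.map_comp, Functor.map_comp, ← Category.assoc, ← Category.assoc, hp, hm])
    exact ⟨r, α, fun β ↦ by rw [Functor.map_comp, Category.assoc, Category.assoc, hα]⟩
  have eqy : ∀ {c : C} {s : J} (m m' : d₁ s ⟶ c),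
      y' s ≫ constant.map m = y' s ≫ constant.map m' →
      ∃ (r : Iᵒᵖ) (α : r ⟶ τ s), ∀ {r' : Iᵒᵖ} (β : r' ⟶ r),
        G.map (β ≫ α) ≫ q s ≫ m = G.map (β ≫ α) ≫ q s ≫ m' := by
    intro c s m m' hm
    obtain ⟨r, α, hα⟩ := ey (q s ≫ m) (q s ≫ m') (by
      rw [Functor.map_comp, Functor.map_comp, ← Category.assoc, ← Category.assoc, hq, hm])
    exact ⟨r, α, fun β ↦ by rw [Functor.map_comp, Category.assoc, Category.assoc, hα]⟩
  have keyx : ∀ {c : C} {r s : Iᵒᵖ} (α : r ⟶ τ s) (m m' : d₀ s ⟶ c),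
      F.map α ≫ p s ≫ m = F.map α ≫ p s ≫ m' →
      (a r ≫ F.map α ≫ p s) ≫ m = (a r ≫ F.map α ≫ p s) ≫ m' := fun α m m' hm ↦ by
    rw [Category.assoc, Category.assoc, Category.assoc, Category.assoc, hm]
  have keyy : ∀ {c : C} {r s : Iᵒᵖ} (α : r ⟶ τ s) (m m' : d₁ s ⟶ c),
      G.map α ≫ q s ≫ m = G.map α ≫ q s ≫ m' →
      (b r ≫ G.map α ≫ q s) ≫ m = (b r ≫ G.map α ≫ q s) ≫ m' := fun α m m' hm ↦ by
    rw [Category.assoc, Category.assoc, Category.assoc, Category.assoc, hm]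
  have facx : ∀ {c : C} (y : X ⟶ constant.obj c), ∃ (t : Iᵒᵖ) (m : d₀ t ⟶ c),
      x' t ≫ constant.map m = y := fun y ↦ by
    obtain ⟨t, m, hm⟩ := exists_eq_proj_comp (e.inv ≫ y)
    refine ⟨t, a t ≫ m, ?_⟩
    rw [Functor.map_comp, ← Category.assoc, h3]
    exact (Category.assoc _ _ _).trans ((Iso.inv_comp_eq _).1 hm).symm
  have facy : ∀ {c : C} (y : Y ⟶ constant.obj c), ∃ (t : Iᵒᵖ) (m : d₁ t ⟶ c),
      y' t ≫ constant.map m = y := fun y ↦ by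
    obtain ⟨t, m, hm⟩ := exists_eq_proj_comp (e'.inv ≫ y)
    refine ⟨t, b t ≫ m, ?_⟩
    rw [Functor.map_comp, ← Category.assoc, h4]
    exact (Category.assoc _ _ _).trans ((Iso.inv_comp_eq _).1 hm).symm
  have hJ : IsCofiltered J :=
    { cone_objs s s' := by
        obtain ⟨m, -⟩ := mor (IsCofiltered.minToLeft (τ s) (τ s'))
        obtain ⟨m', -⟩ := mor (IsCofiltered.minToRight (τ s) (τ s'))
        exact ⟨_, m, m', trivial⟩
      cone_maps s s' m m' := by
        obtain ⟨r, α, hα⟩ := eqx (D.map m).left (D.map m').left (by rw [hDx, hDx])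
        obtain ⟨r', α', hα'⟩ := eqy (D.map m).right (D.map m').right (by rw [hDy, hDy])
        let β := IsCofiltered.minToLeft r r'
        let β' := IsCofiltered.minToRight r r'
        have hβ : β ≫ α = β' ≫ α' := Subsingleton.elim _ _
        obtain ⟨n, hn, hn'⟩ := mor (β ≫ α)
        refine ⟨_, n, InducedCategory.hom_ext (StructuredArrow.ext _ _ ?_)⟩
        change D.map (n ≫ m) = D.map (n ≫ m')
        rw [D.map_comp, D.map_comp]
        refine Arrow.hom_ext _ _ ?_ ?_
        · rw [Arrow.comp_left, Arrow.comp_left, hn]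
          exact keyx _ _ _ (hα β)
        · rw [Arrow.comp_right, Arrow.comp_right, hn', hβ]
          exact keyy _ _ _ (hα' β')
      nonempty := inferInstanceAs (Nonempty Iᵒᵖ) }
  obtain ⟨i, hi⟩ := exists_iso_of_cone (D ⋙ Arrow.leftFunc) x' hDx
    facx
    (fun {c} s m m' hm ↦ by
      obtain ⟨r, α, hα⟩ := eqx m m' hm
      obtain ⟨n, hn, -⟩ := mor α
      have := hα (𝟙 r)
      rw [Category.id_comp] at this
      refine ⟨r, n, ?_⟩
      change (D.map n).left ≫ m = (D.map n).left ≫ m'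
      rw [hn]
      exact keyx _ _ _ this)
  obtain ⟨j, hj⟩ := exists_iso_of_cone (D ⋙ Arrow.rightFunc) y' hDy
    facy
    (fun {c} s m m' hm ↦ by
      obtain ⟨r, α, hα⟩ := eqy m m' hm
      obtain ⟨n, -, hn⟩ := mor α
      have := hα (𝟙 r)
      rw [Category.id_comp] at this
      refine ⟨r, n, ?_⟩
      change (D.map n).right ≫ m = (D.map n).right ≫ m'
      rw [hn]
      exact keyy _ _ _ this)
  refine ⟨J, _, hJ, _, _, Functor.whiskerLeft D Arrow.leftToRight, ⟨i, j, ?_⟩, fun s ↦ hw s⟩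
  refine hom_ext_proj fun s ↦ ?_
  rw [Category.assoc, hj, Category.assoc, levelMap_proj, ← Category.assoc, hi]
  exact (h1 s).symm

lemma essentiallyLevelwise_iff {P : MorphismProperty C} {X Y : ProObject C} {f : X ⟶ Y} :
    essentiallyLevelwise P f ↔ FactorsThrough P f :=
  ⟨factorsThrough_of_essentiallyLevelwise, essentiallyLevelwise_of_factorsThrough⟩

instance isStableUnderRetracts_essentiallyLevelwise (P : MorphismProperty C) :
    (essentiallyLevelwise P).IsStableUnderRetracts where
  of_retract h hg := by
    rw [essentiallyLevelwise_iff] at hg ⊢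
    exact FactorsThrough.of_retract h.i.left h.i.right h.r.left h.r.right h.i_w.symm
      h.r_w.symm h.retract_left h.retract_right hg

/-! ### Finite limits of constant and levelwise diagrams -/

lemma exists_eq_proj_comp₂ {X : ProObject C} {c d : C} (x : X ⟶ constant.obj c)
    (y : X ⟶ constant.obj d) :
    ∃ (t : X.Index) (f : X.diagram.obj t ⟶ c) (g : X.diagram.obj t ⟶ d),
      x = X.proj t ≫ constant.map f ∧ y = X.proj t ≫ constant.map g := by
  obtain ⟨t, f, rfl⟩ := exists_eq_proj_comp x
  obtain ⟨t', g, rfl⟩ := exists_eq_proj_comp y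
  refine ⟨IsCofiltered.min t t', X.diagram.map (IsCofiltered.minToLeft t t') ≫ f,
    X.diagram.map (IsCofiltered.minToRight t t') ≫ g, ?_, ?_⟩ <;>
  rw [Functor.map_comp, proj_map_assoc]

/-- Uniqueness of maps to a pullback of constant pro-objects; existence is
`exists_lift_of_isPullback`. -/
lemma hom_constant_ext_of_isPullback {P A B D : C} {p : P ⟶ A} {q : P ⟶ B} {a : A ⟶ D}
    {b : B ⟶ D} (h : IsPullback p q a b) {W : ProObject C} {x y : W ⟶ constant.obj P}
    (h₁ : x ≫ constant.map p = y ≫ constant.map p)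
    (h₂ : x ≫ constant.map q = y ≫ constant.map q) : x = y := by
  obtain ⟨t, f, g, rfl, rfl⟩ := exists_eq_proj_comp₂ x y
  rw [Category.assoc, Category.assoc, ← Functor.map_comp, ← Functor.map_comp] at h₁ h₂
  obtain ⟨r, α, hα⟩ := exists_map_comp_eq _ _ _ h₁
  rw [← W.proj_map_assoc α, ← W.proj_map_assoc α, ← Functor.map_comp, ← Functor.map_comp] at h₂
  obtain ⟨s, β, hβ⟩ := exists_map_comp_eq _ _ _ h₂
  rw [← W.proj_map α, ← W.proj_map β, Category.assoc, Category.assoc, Category.assoc,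
    Category.assoc]
  congr 1
  rw [← Functor.map_comp, ← Functor.map_comp, ← Functor.map_comp, ← Functor.map_comp]
  congr 1
  apply h.hom_ext
  · simp only [Category.assoc, hα]
  · simpa only [Category.assoc] using hβ

lemma isPullback_constant_map {P A B D : C} {p : P ⟶ A} {q : P ⟶ B} {a : A ⟶ D}
    {b : B ⟶ D} (h : IsPullback p q a b) :
    IsPullback (constant.map p) (constant.map q) (constant.map a) (constant.map b) where
  w := by rw [← Functor.map_comp, h.w, Functor.map_comp]
  isLimit' := ⟨PullbackCone.isLimitAux' _ fun s ↦ by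
    apply Classical.choice
    have hs := s.condition
    obtain ⟨t, f, g, hf, hg⟩ := exists_eq_proj_comp₂ s.fst s.snd
    rw [hf, hg, Category.assoc, Category.assoc, ← Functor.map_comp, ← Functor.map_comp] at hs
    obtain ⟨r, α, hα⟩ := exists_map_comp_eq _ _ _ hs
    obtain ⟨l, hl₁, hl₂⟩ : ∃ l : s.pt ⟶ constant.obj P,
        l ≫ constant.map p = s.fst ∧ l ≫ constant.map q = s.snd := by
      have hα' : (s.pt.diagram.map α ≫ f) ≫ a = (s.pt.diagram.map α ≫ g) ≫ b := by
        simpa only [Category.assoc] using hα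
      refine ⟨s.pt.proj r ≫ constant.map (h.lift _ _ hα'), ?_, ?_⟩
      · rw [Category.assoc, ← Functor.map_comp, h.lift_fst, Functor.map_comp, proj_map_assoc, hf]
      · rw [Category.assoc, ← Functor.map_comp, h.lift_snd, Functor.map_comp, proj_map_assoc, hg]
    exact ⟨⟨l, hl₁, hl₂, fun h₁ h₂ ↦
      hom_constant_ext_of_isPullback h (h₁.trans hl₁.symm) (h₂.trans hl₂.symm)⟩⟩⟩

lemma exists_lift_of_isPullback {P A B D : C} {p : P ⟶ A} {q : P ⟶ B} {a : A ⟶ D}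
    {b : B ⟶ D} (h : IsPullback p q a b) {W : ProObject C} (x : W ⟶ constant.obj A)
    (y : W ⟶ constant.obj B) (e : x ≫ constant.map a = y ≫ constant.map b) :
    ∃ l : W ⟶ constant.obj P, l ≫ constant.map p = x ∧ l ≫ constant.map q = y :=
  ⟨(isPullback_constant_map h).lift x y e, (isPullback_constant_map h).lift_fst _ _ _,
    (isPullback_constant_map h).lift_snd _ _ _⟩

lemma hom_levelMap_ext_of_isPullback {I : Type v} [SmallCategory I] [IsCofiltered I]
    {P F H G : I ⥤ C} {p : P ⟶ F} {q : P ⟶ H} {f : F ⟶ G} {g : H ⟶ G}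
    (h : ∀ s, IsPullback (p.app s) (q.app s) (f.app s) (g.app s)) {W : ProObject C}
    {x y : W ⟶ ProObject.mk I P} (h₁ : x ≫ levelMap p = y ≫ levelMap p)
    (h₂ : x ≫ levelMap q = y ≫ levelMap q) : x = y :=
  hom_ext_proj fun s ↦ by
    refine hom_constant_ext_of_isPullback (h s) ?_ ?_
    · rw [Category.assoc, Category.assoc]
      refine (congrArg (x ≫ ·) (levelMap_proj p s).symm).trans
        (Eq.trans ?_ (congrArg (y ≫ ·) (levelMap_proj p s)))
      rw [← Category.assoc, h₁, Category.assoc]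
    · rw [Category.assoc, Category.assoc]
      refine (congrArg (x ≫ ·) (levelMap_proj q s).symm).trans
        (Eq.trans ?_ (congrArg (y ≫ ·) (levelMap_proj q s)))
      rw [← Category.assoc, h₂, Category.assoc]

/-- Levelwise pullback squares are pullback squares of pro-objects. -/
lemma isPullback_levelMap {I : Type v} [SmallCategory I] [IsCofiltered I] {P F H G : I ⥤ C}
    {p : P ⟶ F} {q : P ⟶ H} {f : F ⟶ G} {g : H ⟶ G}
    (h : ∀ s, IsPullback (p.app s) (q.app s) (f.app s) (g.app s)) :
    IsPullback (levelMap p) (levelMap q) (levelMap f) (levelMap g) where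
  w := by
    rw [levelMap_comp_eq, levelMap_comp_eq]
    congr 1
    ext s
    exact (h s).w
  isLimit' := ⟨PullbackCone.isLimitAux' _ fun c ↦ by
    apply Classical.choice
    have hc : ∀ s, (c.fst ≫ (ProObject.mk I F).proj s) ≫ constant.map (f.app s) =
        (c.snd ≫ (ProObject.mk I H).proj s) ≫ constant.map (g.app s) := fun s ↦ by
      rw [Category.assoc, Category.assoc, ← levelMap_proj, ← levelMap_proj, ← Category.assoc,
        c.condition, Category.assoc]
    let x : ∀ s, c.pt ⟶ constant.obj (P.obj s) := fun s ↦
      (isPullback_constant_map (h s)).lift _ _ (hc s)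
    have hx₁ : ∀ s, x s ≫ constant.map (p.app s) = c.fst ≫ (ProObject.mk I F).proj s :=
      fun s ↦ (isPullback_constant_map (h s)).lift_fst _ _ (hc s)
    have hx₂ : ∀ s, x s ≫ constant.map (q.app s) = c.snd ≫ (ProObject.mk I H).proj s :=
      fun s ↦ (isPullback_constant_map (h s)).lift_snd _ _ (hc s)
    obtain ⟨l, hl⟩ := exists_lift (ProObject.mk I P) x fun {s s'} a ↦ by
      refine hom_constant_ext_of_isPullback (h s') ?_ ?_
      · rw [hx₁, Category.assoc, ← Functor.map_comp, p.naturality, Functor.map_comp,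
          ← Category.assoc, hx₁, Category.assoc]
        exact congrArg (c.fst ≫ ·) ((ProObject.mk I F).proj_map a)
      · rw [hx₂, Category.assoc, ← Functor.map_comp, q.naturality, Functor.map_comp,
          ← Category.assoc, hx₂, Category.assoc]
        exact congrArg (c.snd ≫ ·) ((ProObject.mk I H).proj_map a)
    have hl₁ : l ≫ levelMap p = c.fst := hom_ext_proj fun s ↦ by
      rw [Category.assoc, levelMap_proj, ← Category.assoc, hl, hx₁]
    have hl₂ : l ≫ levelMap q = c.snd := hom_ext_proj fun s ↦ by
      rw [Category.assoc, levelMap_proj, ← Category.assoc, hl, hx₂]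
    exact ⟨⟨l, hl₁, hl₂, fun h₁ h₂ ↦
      hom_levelMap_ext_of_isPullback h (h₁.trans hl₁.symm) (h₂.trans hl₂.symm)⟩⟩⟩

/-- Finite limits in `C` remain limits in the pro-category, because filtered colimits of sets
commute with finite limits; it suffices to check pullbacks and the terminal object. -/
lemma preservesFiniteLimits_constant [HasLimits C] :
    PreservesFiniteLimits (constant (C := C)) := by
  have : PreservesLimitsOfShape WalkingCospan (constant (C := C)) :=
    preservesLimitsOfShape_walkingCospan_of_forall_isPullback fun X Y Z f g _ ↦
      ⟨_, _, _, IsPullback.of_hasPullback f g,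
        isPullback_constant_map (IsPullback.of_hasPullback f g)⟩
  have h (X : ProObject C) : Nonempty (Unique (X ⟶ constant.obj (⊤_ C))) :=
    ⟨⟨X.proj IsCofiltered.nonempty.some ≫ constant.map (terminal.from _)⟩, fun x ↦ by
      obtain ⟨t, f, g, rfl, h⟩ := exists_eq_proj_comp₂ x
        (X.proj IsCofiltered.nonempty.some ≫ constant.map (terminal.from _))
      rw [Subsingleton.elim f g]
      exact h.symm⟩
  have ht : IsTerminal (constant.obj (⊤_ C)) := by
    exact IsTerminal.ofUniqueHom (fun X ↦ (h X).some.default) fun X m ↦ (h X).some.uniq m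
  have : PreservesLimit (Functor.empty.{0} C) (constant (C := C)) :=
    preservesLimit_of_preserves_limit_cone terminalIsTerminal
      ((isLimitMapConeEmptyConeEquiv _ _).symm ht)
  have : PreservesLimitsOfShape (Discrete PEmpty.{1}) (constant (C := C)) :=
    preservesLimitsOfShape_pempty_of_preservesTerminal _
  exact preservesFiniteLimits_of_preservesTerminal_and_pullbacks _

/-! ### Limits and colimits of pro-objects -/

/-- A pro-object of `C`, seen as a presheaf on the opposite category. -/
def toPresheaf : (ProObject C)ᵒᵖ ⥤ (Cᵒᵖᵒᵖ ⥤ Type v) where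
  obj X := unopUnop C ⋙ X.unop.corep
  map f := Functor.whiskerLeft (unopUnop C) (homEquiv _ _ f.unop)
  map_id X := by
    change Functor.whiskerLeft (unopUnop C) (homEquiv _ _ ((homEquiv _ _).symm (𝟙 _))) = _
    rw [Equiv.apply_symm_apply]
    rfl
  map_comp f g := by
    change Functor.whiskerLeft (unopUnop C) (homEquiv _ _ ((homEquiv _ _).symm (_ ≫ _))) = _
    rw [Equiv.apply_symm_apply]
    rfl

/-- The functor `toPresheaf` is fully faithful, as morphisms of pro-objects are natural
transformations between the functors they pro-represent. -/
def toPresheafFullyFaithful : (toPresheaf (C := C)).FullyFaithful where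
  preimage {X Y} f := Quiver.Hom.op (V := ProObject C) ((homEquiv Y.unop X.unop).symm
    { app c := f.app (op (op c))
      naturality _ _ g := f.naturality g.op.op })
  map_preimage f := by
    change Functor.whiskerLeft (unopUnop C) (homEquiv _ _ ((homEquiv _ _).symm _)) = _
    rw [Equiv.apply_symm_apply]
    rfl
  preimage_map f := Quiver.Hom.unop_inj ((homEquiv _ _).symm_apply_apply f.unop)

/-- The Yoneda embedding of `Cᵒᵖ` is the Yoneda embedding of `C` in the covariant variable. -/
def coyonedaUnopUnopIso :
    coyoneda ⋙ (Functor.whiskeringLeft _ _ (Type v)).obj (unopUnop C) ≅ yoneda (C := Cᵒᵖ) :=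
  NatIso.ofComponents (fun X ↦ NatIso.ofComponents (fun Y ↦ (opEquiv Y.unop X).symm.toIso)
    (fun _ ↦ rfl)) (fun _ ↦ rfl)

/-- The presheaf of a pro-object is the colimit of the presheaves represented by its terms. -/
def toPresheafPresentation (X : ProObject C) :
    IndObjectPresentation (toPresheaf.obj (op X)) :=
  IndObjectPresentation.ofCocone (F := X.diagram.op) _
    ((IsColimit.precomposeInvEquiv (Functor.isoWhiskerLeft X.diagram.op coyonedaUnopUnopIso) _).symm
      (isColimitOfPreserves ((Functor.whiskeringLeft _ _ (Type v)).obj (unopUnop C))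
        (colimit.isColimit (X.diagram.op ⋙ coyoneda))))

/-- The category of pro-objects of `C` is opposite to the category of ind-objects of `Cᵒᵖ`. -/
def toInd : (ProObject C)ᵒᵖ ⥤ ObjectProperty.FullSubcategory (IsIndObject (C := Cᵒᵖ)) :=
  ObjectProperty.lift _ toPresheaf fun X ↦ ⟨⟨toPresheafPresentation X.unop⟩⟩

instance : (toInd (C := C)).IsEquivalence := by
  have := (toPresheafFullyFaithful (C := C)).full
  have := (toPresheafFullyFaithful (C := C)).faithful
  have h1 : (toInd (C := C)).Full := inferInstanceAs (ObjectProperty.lift _ _ _).Full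
  have h2 : (toInd (C := C)).Faithful := inferInstanceAs (ObjectProperty.lift _ _ _).Faithful
  have h3 : (toInd (C := C)).EssSurj := by
    refine ⟨fun A ↦ ?_⟩
    obtain ⟨⟨P⟩⟩ := A.property
    let X : ProObject C := ProObject.mk P.Iᵒᵖ P.F.leftOp
    let e : X.diagram.op ⋙ yoneda ≅ (opOpEquivalence P.I).functor ⋙ P.F ⋙ yoneda :=
      NatIso.ofComponents (fun i ↦ Iso.refl _)
        (fun _ ↦ (Category.comp_id _).trans (Category.id_comp _).symm)
    have h := (toPresheafPresentation X).coconeIsColimit.coconePointsIsoOfNatIso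
      (P.coconeIsColimit.whiskerEquivalence (opOpEquivalence P.I)) e
    exact ⟨op X, ⟨ObjectProperty.isoMk _ h⟩⟩
  exact {}

/-- The category of pro-objects has limits because ind-objects have colimits. -/
lemma hasLimits_proObject [HasLimits C] : HasLimits (ProObject C) := by
  have : HasColimitsOfSize.{v, v} (ObjectProperty.FullSubcategory (IsIndObject (C := Cᵒᵖ))) :=
    Adjunction.has_colimits_of_equivalence (Ind.equivalence Cᵒᵖ).inverse
  have : HasColimitsOfSize.{v, v} (ProObject C)ᵒᵖ :=
    Adjunction.has_colimits_of_equivalence (toInd (C := C))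
  exact hasLimits_of_hasColimits_op

/-- The category of pro-objects has colimits because ind-objects have limits. -/
lemma hasColimits_proObject [HasColimits C] : HasColimits (ProObject C) := by
  have : HasLimitsOfSize.{v, v} (ObjectProperty.FullSubcategory (IsIndObject (C := Cᵒᵖ))) :=
    Adjunction.has_limits_of_equivalence (Ind.equivalence Cᵒᵖ).inverse
  have : HasLimitsOfSize.{v, v} (ProObject C)ᵒᵖ :=
    Adjunction.has_limits_of_equivalence (toInd (C := C))
  exact hasColimits_of_hasLimits_op

/-! ### Two out of three for strict weak equivalences -/

section WeakEquivalences

variable [ModelCategory C]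

open MorphismProperty

/-- Composition: a map from `f ≫ g` to `k` yields weak equivalences `A ⟶ B` receiving a map from `f`
and `B' ⟶ D` receiving a map from `g`, with a map `B' ⟶ B` between them. Pulling back the former and
pushing out the latter makes them composable. -/
lemma FactorsThrough.comp (hC : IsProperModelCategory C) {X Y Z : ProObject C} {f : X ⟶ Y}
    {g : Y ⟶ Z} (hf : FactorsThrough (weakEquivalences C) f)
    (hg : FactorsThrough (weakEquivalences C) g) :
    FactorsThrough (weakEquivalences C) (f ≫ g) := by
  intro c₀ c₁ k x z e
  obtain ⟨A, B, w₁, x₁, y₁, a, b, hw₁, e₁, e₂, e₃, e₄⟩ := hf k x (g ≫ z) (by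
    rw [e, Category.assoc])
  obtain ⟨B', D, w₂, y₂, z₂, b', d, hw₂, e₅, e₆, e₇, e₈⟩ := hg b y₁ z e₄
  -- replace `B' ⟶ B` by a fibration, so that right properness applies
  let F := factorizationData (trivialCofibrations C) (fibrations C) b'
  have hinl : weakEquivalences C (pushout.inl w₂ F.i) :=
    ((trivialCofibrations C).of_isPushout (IsPushout.of_hasPushout w₂ F.i) F.hi).2
  have hinr : weakEquivalences C (pushout.inr w₂ F.i) := by
    refine (weakEquivalences C).of_precomp F.i _ F.hi.2 ?_
    rw [← pushout.condition]
    exact (weakEquivalences C).comp_mem _ _ hw₂ hinl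
  have hsnd : weakEquivalences C (pullback.snd w₁ F.p) :=
    hC.right (IsPullback.of_hasPullback w₁ F.p).flip F.hp hw₁
  have hF : ∀ {T : C} (h : B ⟶ T), F.i ≫ F.p ≫ h = b' ≫ h := fun h ↦ by
    rw [← Category.assoc, F.fac]
  obtain ⟨l, hl₁, hl₂⟩ := exists_lift_of_isPullback (IsPullback.of_hasPullback w₁ F.p) x₁
    (f ≫ y₂ ≫ constant.map F.i) (by
      rw [e₁, Category.assoc, Category.assoc, ← Functor.map_comp, F.fac, e₇])
  let m : pushout w₂ F.i ⟶ c₁ := pushout.desc d (F.p ≫ b) (by rw [hF, e₆])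
  refine ⟨_, _, pullback.snd w₁ F.p ≫ pushout.inr w₂ F.i, l, z₂ ≫ constant.map (pushout.inl w₂ F.i),
    pullback.fst w₁ F.p ≫ a, m, (weakEquivalences C).comp_mem _ _ hsnd hinr, ?_, ?_, ?_, ?_⟩
  · rw [Functor.map_comp, ← Category.assoc, hl₂, Category.assoc, Category.assoc,
      ← Functor.map_comp, ← pushout.condition, Functor.map_comp, Category.assoc,
      ← Category.assoc y₂, e₅, Category.assoc]
  · rw [Category.assoc, pushout.inr_desc, ← Category.assoc, ← pullback.condition, Category.assoc,
      e₂, Category.assoc]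
  · rw [Functor.map_comp, ← Category.assoc, hl₁, e₃]
  · rw [Category.assoc, ← Functor.map_comp, pushout.inl_desc, e₈]

/-- Cancellation on the left. A weak equivalence `w₁ : A ⟶ D` receiving a map from `f ≫ g` factors
through the pullback `c₀ ×_{c₁} D`, to which `Y` maps; the map from `f` to `A ⟶ c₀ ×_{c₁} D` factors
through a weak equivalence `w₂ : W₀ ⟶ W₁`, and the arrow wanted for `g` is the map to `D` from the
pushout of `w₂` along `W₀ ⟶ A`, with `W₀ ⟶ A` made a cofibration. -/
lemma FactorsThrough.of_precomp [HasLimits C] (hC : IsProperModelCategory C)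
    {X Y Z : ProObject C} {f : X ⟶ Y}
    {g : Y ⟶ Z} (hf : FactorsThrough (weakEquivalences C) f)
    (hfg : FactorsThrough (weakEquivalences C) (f ≫ g)) :
    FactorsThrough (weakEquivalences C) g := by
  intro c₀ c₁ k y z e
  obtain ⟨A, D, w₁, x₁, z₁, a, d, hw₁, e₁, e₂, e₃, e₄⟩ := hfg k (f ≫ y) z (by
    rw [Category.assoc, e, Category.assoc])
  have hL := IsPullback.of_hasPullback k d
  let u : A ⟶ pullback k d := pullback.lift a w₁ e₂.symm
  have hu₁ : u ≫ pullback.fst k d = a := pullback.lift_fst _ _ _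
  have hu₂ : u ≫ pullback.snd k d = w₁ := pullback.lift_snd _ _ _
  obtain ⟨y₂, hy₁, hy₂⟩ := exists_lift_of_isPullback hL y (g ≫ z₁) (by
    rw [e, Category.assoc, e₄])
  obtain ⟨W₀, W₁, w₂, x₃, y₃, p, q, hw₂, e₅, e₆, e₇, e₈⟩ := hf u x₁ y₂ (by
    refine hom_constant_ext_of_isPullback hL ?_ ?_
    · rw [Category.assoc, Category.assoc, ← Functor.map_comp, hu₁, hy₁, e₃]
    · rw [Category.assoc, Category.assoc, ← Functor.map_comp, hu₂, hy₂, e₁, Category.assoc])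
  -- replace `W₀ ⟶ A` by a cofibration, so that left properness applies
  let F := factorizationData (cofibrations C) (trivialFibrations C) p
  have hinl : weakEquivalences C (pushout.inl F.i w₂) :=
    hC.left (IsPushout.of_hasPushout F.i w₂) F.hi hw₂
  have hF : ∀ {T : C} (h : A ⟶ T), F.i ≫ F.p ≫ h = p ≫ h := fun h ↦ by
    rw [← Category.assoc, F.fac]
  let m : pushout F.i w₂ ⟶ D := pushout.desc (F.p ≫ w₁) (q ≫ pullback.snd k d) (by
    rw [hF, ← hu₂, ← Category.assoc, ← e₆, Category.assoc])
  let n : pushout F.i w₂ ⟶ c₀ := pushout.desc (F.p ≫ a) (q ≫ pullback.fst k d) (by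
    rw [hF, ← hu₁, ← Category.assoc, ← e₆, Category.assoc])
  have hm : weakEquivalences C m := by
    refine (weakEquivalences C).of_precomp _ m hinl ?_
    rw [pushout.inl_desc]
    exact (weakEquivalences C).comp_mem _ _ F.hp.2 hw₁
  refine ⟨_, _, m, y₃ ≫ constant.map (pushout.inr F.i w₂), z₁, n, d, hm, ?_, ?_, ?_, e₄⟩
  · rw [Category.assoc, ← Functor.map_comp, pushout.inr_desc, Functor.map_comp, ← Category.assoc,
      e₈, hy₂]
  · refine pushout.hom_ext ?_ ?_
    · rw [← Category.assoc, ← Category.assoc, pushout.inl_desc, pushout.inl_desc, Category.assoc,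
        Category.assoc, e₂]
    · rw [← Category.assoc, ← Category.assoc, pushout.inr_desc, pushout.inr_desc, Category.assoc,
        Category.assoc, pullback.condition]
  · rw [Category.assoc, ← Functor.map_comp, pushout.inr_desc, Functor.map_comp, ← Category.assoc,
      e₈, hy₁]

/-- Cancellation on the right. The map `Y ⟶ c₁` factors through a weak equivalence `w₂ : W₀ ⟶ W₁`
receiving a map from `g`; then `X` maps to `c₀ ×_{c₁} W₀`, and the map from `f ≫ g` to
`c₀ ×_{c₁} W₀ ⟶ W₁` factors through a weak equivalence `w₃ : A ⟶ D`. The arrow wanted for `f` is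
`A ⟶ W₀ ×_{W₁} D`, with `D ⟶ W₁` made a fibration. -/
lemma FactorsThrough.of_postcomp [HasLimits C] (hC : IsProperModelCategory C)
    {X Y Z : ProObject C} {f : X ⟶ Y}
    {g : Y ⟶ Z} (hg : FactorsThrough (weakEquivalences C) g)
    (hfg : FactorsThrough (weakEquivalences C) (f ≫ g)) :
    FactorsThrough (weakEquivalences C) f := by
  intro c₀ c₁ k x y e
  have := preservesFiniteLimits_constant (C := C)
  have hT : IsTerminal (constant.obj (⊤_ C)) :=
    terminalIsTerminal.isTerminalObj (constant (C := C)) (⊤_ C)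
  obtain ⟨W₀, W₁, w₂, y₁, z₁, b, t, hw₂, e₁, -, e₂, -⟩ :=
    hg (terminal.from c₁) y (hT.from Z) (hT.hom_ext _ _)
  have hL := IsPullback.of_hasPullback k b
  obtain ⟨x₁, hx₁, hx₂⟩ := exists_lift_of_isPullback hL x (f ≫ y₁) (by
    rw [e, Category.assoc, e₂])
  obtain ⟨A, D, w₃, x₂, z₂, p, q, hw₃, e₃, e₄, e₅, e₆⟩ :=
    hfg (pullback.snd k b ≫ w₂) x₁ z₁ (by
      rw [Functor.map_comp, ← Category.assoc, hx₂, Category.assoc, e₁, Category.assoc])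
  -- replace `D ⟶ W₁` by a fibration, so that right properness applies
  let F := factorizationData (trivialCofibrations C) (fibrations C) q
  have hE := IsPullback.of_hasPullback w₂ F.p
  have hsnd : weakEquivalences C (pullback.snd w₂ F.p) := hC.right hE.flip F.hp hw₂
  let m : A ⟶ pullback w₂ F.p := pullback.lift (p ≫ pullback.snd k b) (w₃ ≫ F.i) (by
    rw [Category.assoc, Category.assoc, F.fac, e₄])
  have hm₁ : m ≫ pullback.fst w₂ F.p = p ≫ pullback.snd k b := pullback.lift_fst _ _ _
  have hm₂ : m ≫ pullback.snd w₂ F.p = w₃ ≫ F.i := pullback.lift_snd _ _ _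
  have hm : weakEquivalences C m := by
    refine (weakEquivalences C).of_postcomp m _ hsnd ?_
    rw [hm₂]
    exact (weakEquivalences C).comp_mem _ _ hw₃ F.hi.2
  obtain ⟨y₂, hy₁, hy₂⟩ := exists_lift_of_isPullback hE y₁ (g ≫ z₂ ≫ constant.map F.i) (by
    rw [e₁, Category.assoc, Category.assoc, ← Functor.map_comp, F.fac, e₆])
  refine ⟨_, _, m, x₂, y₂, p ≫ pullback.fst k b, pullback.fst w₂ F.p ≫ b, hm, ?_, ?_, ?_, ?_⟩
  · refine hom_constant_ext_of_isPullback hE ?_ ?_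
    · rw [Category.assoc, Category.assoc, ← Functor.map_comp, hm₁, Functor.map_comp,
        ← Category.assoc, e₅, hx₂, hy₁]
    · rw [Category.assoc, Category.assoc, ← Functor.map_comp, hm₂, Functor.map_comp,
        ← Category.assoc, e₃, hy₂, Category.assoc, Category.assoc]
  · rw [← Category.assoc, hm₁, Category.assoc, Category.assoc, pullback.condition]
  · rw [Functor.map_comp, ← Category.assoc, e₅, hx₁]
  · rw [Functor.map_comp, ← Category.assoc, hy₁, e₂]

lemma hasTwoOutOfThreeProperty_strictWeakEquivalences [HasLimits C]
    (hC : IsProperModelCategory C) :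
    (strictWeakEquivalences C).HasTwoOutOfThreeProperty where
  comp_mem f g hf hg := by
    rw [strictWeakEquivalences, essentiallyLevelwise_iff] at *
    exact hf.comp hC hg
  of_postcomp f g hg hfg := by
    rw [strictWeakEquivalences, essentiallyLevelwise_iff] at *
    exact hg.of_postcomp hC hfg
  of_precomp f g hf hfg := by
    rw [strictWeakEquivalences, essentiallyLevelwise_iff] at *
    exact hf.of_precomp hC hfg

/-! ### Properness -/

/-- The pushout of a strict weak equivalence along a strict cofibration is a strict weak
equivalence. A map from `w'` to `k` restricts to a map from `w` to `k`, which factors through a weak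
equivalence `m : W₀ ⟶ W₁`; the map from `i` to `W₀ ⟶ c₀` factors through a cofibration
`j : K₀ ⟶ K₁`, and the arrow wanted is the cobase change of `m` along the pushout of `j`. -/
lemma strictWeakEquivalences_of_isPushout (hC : IsProperModelCategory C)
    {A B A' B' : ProObject C} {i : A ⟶ B} {w : A ⟶ A'} {w' : B ⟶ B'} {i' : A' ⟶ B'}
    (sq : IsPushout i w w' i') (hi : strictCofibrations C i)
    (hw : strictWeakEquivalences C w) : strictWeakEquivalences C w' := by
  rw [strictWeakEquivalences, essentiallyLevelwise_iff] at *
  rw [strictCofibrations, essentiallyLevelwise_iff] at hi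
  intro c₀ c₁ k x y e
  obtain ⟨W₀, W₁, m, x₁, y₁, a, b, hm, e₁, e₂, e₃, e₄⟩ := hw k (i ≫ x) (i' ≫ y) (by
    rw [Category.assoc, e, ← Category.assoc, sq.w, Category.assoc])
  obtain ⟨K₀, K₁, j, x₂, y₂, p, q, hj, e₅, e₆, e₇, e₈⟩ := hi a x₁ x e₃
  let r : pushout p j ⟶ pushout (p ≫ m) j :=
    pushout.map p j (p ≫ m) j m (𝟙 _) (𝟙 _) (by simp) (by simp)
  have hr₁ : pushout.inl p j ≫ r = m ≫ pushout.inl (p ≫ m) j := pushout.inl_desc _ _ _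
  have hr₂ : pushout.inr p j ≫ r = pushout.inr (p ≫ m) j :=
    (pushout.inr_desc _ _ _).trans (Category.id_comp _)
  -- the cobase change of `m` along the cofibration `W₀ ⟶ W₀ ⊔ K₁` is a weak equivalence
  have hsq : IsPushout (pushout.inl p j) m r (pushout.inl (p ≫ m) j) := by
    refine (IsPushout.of_left (h₁₁ := p) (v₁₁ := j) (h₂₁ := pushout.inr p j) ?_ hr₁.symm
      (IsPushout.of_hasPushout p j)).flip
    rw [hr₂]
    exact IsPushout.of_hasPushout (p ≫ m) j
  have hr : weakEquivalences C r :=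
    hC.left hsq ((cofibrations C).of_isPushout (IsPushout.of_hasPushout p j) hj) hm
  have hl : i ≫ y₂ ≫ constant.map (pushout.inr (p ≫ m) j) =
      w ≫ y₁ ≫ constant.map (pushout.inl (p ≫ m) j) := by
    rw [← Category.assoc, ← e₅, ← Category.assoc, ← e₁, ← e₇]
    simp only [Category.assoc, ← Functor.map_comp]
    rw [← pushout.condition, Category.assoc]
  let n₀ : pushout p j ⟶ c₀ := pushout.desc a q e₆.symm
  let n₁ : pushout (p ≫ m) j ⟶ c₁ := pushout.desc b (q ≫ k) (by
    rw [Category.assoc, e₂, ← Category.assoc, ← e₆, Category.assoc])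
  refine ⟨_, _, r, y₂ ≫ constant.map (pushout.inr p j), sq.desc _ _ hl, n₀, n₁, hr, ?_, ?_, ?_, ?_⟩
  · rw [sq.inl_desc, Category.assoc, ← Functor.map_comp, hr₂]
  · refine pushout.hom_ext ?_ ?_
    · rw [← Category.assoc, ← Category.assoc, hr₁, Category.assoc, pushout.inl_desc,
        pushout.inl_desc, e₂]
    · rw [← Category.assoc, ← Category.assoc, hr₂, pushout.inr_desc, pushout.inr_desc]
  · rw [Category.assoc, ← Functor.map_comp, pushout.inr_desc, e₈]
  · refine sq.hom_ext ?_ ?_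
    · rw [← Category.assoc, sq.inl_desc, Category.assoc, ← Functor.map_comp, pushout.inr_desc,
        Functor.map_comp, ← Category.assoc, e₈, e]
    · rw [← Category.assoc, sq.inr_desc, Category.assoc, ← Functor.map_comp, pushout.inl_desc, e₄]

/-- The pullback of a strict weak equivalence along an essentially levelwise fibration is a strict
weak equivalence. After reindexing, the pullback is computed levelwise. -/
lemma strictWeakEquivalences_of_isPullback (hC : IsProperModelCategory C)
    {X Y X' Y' : ProObject C} {w' : X' ⟶ X} {p' : X' ⟶ Y'} {p : X ⟶ Y} {w : Y' ⟶ Y}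
    (sq : IsPullback w' p' p w) (hp : essentiallyLevelwise (fibrations C) p)
    (hw : strictWeakEquivalences C w) : strictWeakEquivalences C w' := by
  rw [strictWeakEquivalences, essentiallyLevelwise_iff] at hw ⊢
  obtain ⟨I, _, _, F, G, φ, ⟨α, β, hφ⟩, hfib⟩ := hp
  obtain ⟨J, _, _, ρ, H, ψ, ε, γ, hρ, hγ, hψ⟩ := exists_level_map (w ≫ β.hom)
  obtain ⟨δ, hδ⟩ := exists_iso_of_initial F ρ
  -- the given square is isomorphic to a levelwise pullback square
  let φ' : ρ ⋙ F ⟶ ρ ⋙ G := Functor.whiskerLeft ρ φ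
  have hlev := isPullback_levelMap (p := pullback.fst φ' ψ) (q := pullback.snd φ' ψ)
    (f := φ') (g := ψ)
    (fun s ↦ (IsPullback.of_hasPullback φ' ψ).map ((evaluation J C).obj s))
  have hφ' : p ≫ (β ≪≫ γ).hom = (α ≪≫ δ).hom ≫ levelMap φ' := by
    rw [Iso.trans_hom, Iso.trans_hom, ← Category.assoc, hφ, Category.assoc, Category.assoc]
    congr 1
    refine hom_ext_proj fun s ↦ ?_
    rw [Category.assoc, Category.assoc, hγ, levelMap_proj, levelMap_proj, ← Category.assoc, hδ]
    rfl
  have hψ' : w ≫ (β ≪≫ γ).hom = ε.hom ≫ levelMap ψ := by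
    rw [Iso.trans_hom, ← Category.assoc, hψ]
  generalize α ≪≫ δ = α' at hφ'
  generalize β ≪≫ γ = β' at hφ' hψ'
  obtain ⟨e, he₁, he₂⟩ : ∃ e : X' ≅ ProObject.mk J (pullback φ' ψ),
      w' ≫ α'.hom = e.hom ≫ levelMap (pullback.fst φ' ψ) ∧
      p' ≫ ε.hom = e.hom ≫ levelMap (pullback.snd φ' ψ) := by
    have h := hlev.of_iso (Iso.refl _) α'.symm ε.symm β'.symm (Category.id_comp _).symm
      (Category.id_comp _).symm (f' := p) (g' := w)
      (by rw [Iso.symm_hom, Iso.symm_hom, Iso.comp_inv_eq, Category.assoc, hφ',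
        Iso.inv_hom_id_assoc])
      (by rw [Iso.symm_hom, Iso.symm_hom, Iso.comp_inv_eq, Category.assoc, hψ',
        Iso.inv_hom_id_assoc])
    refine ⟨sq.isoIsPullback _ _ h, ?_, ?_⟩
    · rw [← Iso.eq_comp_inv, Category.assoc]
      exact (sq.isoIsPullback_hom_fst _ _ h).symm
    · rw [← Iso.eq_comp_inv, Category.assoc]
      exact (sq.isoIsPullback_hom_snd _ _ h).symm
  intro c₀ c₁ k x y hxy
  obtain ⟨j, a, b, hab, ha, hb⟩ := exists_level_factorization (pullback.fst φ' ψ) k (e.inv ≫ x)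
    (α'.inv ≫ y) (by
      rw [Category.assoc, hxy, Iso.inv_comp_eq, ← Category.assoc, ← he₁]
      simp)
  have hj : IsPullback ((pullback.fst φ' ψ).app j) ((pullback.snd φ' ψ).app j) (φ'.app j)
      (ψ.app j) := (IsPullback.of_hasPullback φ' ψ).map ((evaluation J C).obj j)
  obtain ⟨W₀, W₁, m, y₁, z₁, u, t, hm, e₁, e₂, e₃, e₄⟩ := hw (ψ.app j)
    (ε.hom ≫ (ProObject.mk J H).proj j) (β'.hom ≫ (ProObject.mk J (ρ ⋙ G)).proj j) (by
      rw [Category.assoc, ← levelMap_proj, ← Category.assoc, ← hψ', Category.assoc])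
  have hA₁ := IsPullback.of_hasPullback (φ'.app j) t
  have hA₀ := IsPullback.of_hasPullback (pullback.snd (φ'.app j) t) m
  have hwe : weakEquivalences C (pullback.fst (pullback.snd (φ'.app j) t) m) :=
    hC.right hA₀ ((fibrations C).of_isPullback hA₁ (hfib (ρ.obj j))) hm
  let l : pullback (pullback.snd (φ'.app j) t) m ⟶ (pullback φ' ψ).obj j :=
    hj.lift (pullback.fst _ _ ≫ pullback.fst _ _) (pullback.snd _ _ ≫ u) (by
      rw [Category.assoc, pullback.condition, ← Category.assoc, pullback.condition, Category.assoc,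
        e₂, Category.assoc])
  have hl₁ : l ≫ (pullback.fst φ' ψ).app j = pullback.fst _ _ ≫ pullback.fst _ _ :=
    hj.lift_fst _ _ _
  have hl₂ : l ≫ (pullback.snd φ' ψ).app j = pullback.snd _ _ ≫ u := hj.lift_snd _ _ _
  obtain ⟨y', hy₁, hy₂⟩ := exists_lift_of_isPullback hA₁
    (α'.hom ≫ (ProObject.mk J (ρ ⋙ F)).proj j) (p ≫ z₁) (by
      rw [Category.assoc, ← levelMap_proj, ← Category.assoc, ← hφ', Category.assoc, ← e₄,
        Category.assoc])
  obtain ⟨x', hx₁, hx₂⟩ := exists_lift_of_isPullback hA₀ (w' ≫ y') (p' ≫ y₁) (by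
    rw [Category.assoc, hy₂, ← Category.assoc, sq.w, Category.assoc, Category.assoc, e₁])
  have hx : x' ≫ constant.map l = e.hom ≫ (ProObject.mk J (pullback φ' ψ)).proj j := by
    refine hom_constant_ext_of_isPullback hj ?_ ?_
    · rw [Category.assoc, ← Functor.map_comp, hl₁, Functor.map_comp, ← Category.assoc, hx₁,
        Category.assoc, hy₁, ← Category.assoc, he₁, Category.assoc, Category.assoc, levelMap_proj]
    · rw [Category.assoc, ← Functor.map_comp, hl₂, Functor.map_comp, ← Category.assoc, hx₂,
        Category.assoc, e₃, ← Category.assoc, he₂, Category.assoc, Category.assoc, levelMap_proj]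
  refine ⟨_, _, pullback.fst (pullback.snd (φ'.app j) t) m, x', y', l ≫ a,
    pullback.fst (φ'.app j) t ≫ b, hwe, hx₁, ?_, ?_, ?_⟩
  · rw [← Category.assoc, ← hl₁, Category.assoc, hab, Category.assoc]
  · rw [Functor.map_comp, ← Category.assoc, hx, Category.assoc, ha, Iso.hom_inv_id_assoc]
  · rw [Functor.map_comp, ← Category.assoc, hy₁, Category.assoc, hb, Iso.hom_inv_id_assoc]

end WeakEquivalences

/-! ### Lifting properties -/

/-- A morphism satisfying the factorization criterion for `L` has the left lifting property with
respect to constant morphisms against which `L` lifts. -/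
lemma FactorsThrough.hasLiftingProperty_constant {L : MorphismProperty C} {X Y : ProObject C}
    {f : X ⟶ Y} (hf : FactorsThrough L f) {c d : C} {r : c ⟶ d} (hr : L.rlp r) :
    HasLiftingProperty f (constant.map r) where
  sq_hasLift {x y} sq := by
    obtain ⟨d₀, d₁, w, x', y', a, b, hw, e₁, e₂, e₃, e₄⟩ := hf r x y sq.w
    have := hr w hw
    have sq' : CommSq a w r b := ⟨e₂.symm⟩
    refine ⟨⟨⟨y' ≫ constant.map sq'.lift, ?_, ?_⟩⟩⟩
    · rw [← Category.assoc, ← e₁, Category.assoc, ← Functor.map_comp, sq'.fac_left, e₃]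
    · rw [Category.assoc, ← Functor.map_comp, sq'.fac_right, e₄]

/-- A morphism that is both a strict cofibration and a strict weak equivalence is essentially
levelwise an acyclic cofibration: factor a map from `f` to `k` through a weak equivalence `w`, write
`w` as a cofibration followed by an acyclic fibration, and lift `f` against the latter. -/
lemma factorsThrough_trivialCofibrations [ModelCategory C] {X Y : ProObject C} {f : X ⟶ Y}
    (hf : FactorsThrough (cofibrations C) f) (hf' : FactorsThrough (weakEquivalences C) f) :
    FactorsThrough (trivialCofibrations C) f := by
  intro c₀ c₁ k x y e
  obtain ⟨W₀, W₁, w, x', y', a, b, hw, e₁, e₂, e₃, e₄⟩ := hf' k x y e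
  let F := MorphismProperty.factorizationData (cofibrations C) (trivialFibrations C) w
  have hp : (cofibrations C).rlp F.p := by
    rw [MorphismProperty.rlp_eq_of_wfs (cofibrations C) (trivialFibrations C)]
    exact F.hp
  have hi : weakEquivalences C F.i :=
    (weakEquivalences C).of_postcomp F.i F.p F.hp.2 (by rwa [F.fac])
  have := hf.hasLiftingProperty_constant hp
  have sq : CommSq (x' ≫ constant.map F.i) f (constant.map F.p) y' :=
    ⟨by rw [Category.assoc, ← Functor.map_comp, F.fac, e₁]⟩
  refine ⟨_, _, F.i, x', sq.lift, a, F.p ≫ b, ⟨F.hi, hi⟩, sq.fac_left.symm, ?_, e₃, ?_⟩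
  · rw [← Category.assoc, F.fac, e₂]
  · rw [Functor.map_comp, ← Category.assoc, sq.fac_right, e₄]

lemma wellFoundedLT_of_cofinite {I : Type v} [PartialOrder I]
    (hI : ∀ t : I, (Set.Iic t).Finite) : WellFoundedLT I := by
  obtain ⟨r, hr⟩ := exists_strictMono_nat hI
  exact hr.wellFoundedLT

/-- The object `lim_{s < t} X_s` is a finite limit when the index poset is cofinite, hence preserved
by functors that preserve finite limits. -/
lemma exists_matchingObj_lift [HasLimits C] {E : Type*} [Category* E] (H : C ⥤ E)
    [PreservesFiniteLimits H] {I : Type v} [PartialOrder I] (hI : ∀ t : I, (Set.Iic t).Finite)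
    (F : Iᵒᵖ ⥤ C) (t : I) {B : E} (x : ∀ s, s < t → (B ⟶ H.obj (F.obj (op s))))
    (hx : ∀ (r s : I) (hr : r ≤ s) (hs : s < t),
      x s hs ≫ H.map (F.map (homOfLE hr).op) = x r (hr.trans_lt hs)) :
    ∃ b : B ⟶ H.obj (matchingObj F t), ∀ s hs, b ≫ H.map (matchingπ F t s hs) = x s hs := by
  have : Fintype {s : I // s < t} := ((hI t).subset (fun _ h ↦ le_of_lt h)).fintype
  let c : Cone (below F t ⋙ H) :=
    { pt := B
      π :=
        { app := fun s ↦ x s.unop.1 s.unop.2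
          naturality := fun s s' a ↦ by
            refine (Category.id_comp _).trans ?_
            exact (hx s'.unop.1 s.unop.1 (leOfHom a.unop) s.unop.2).symm } }
  exact ⟨(isLimitOfPreserves H (limit.isLimit (below F t))).lift c,
    fun s hs ↦ (isLimitOfPreserves H (limit.isLimit (below F t))).fac c (op ⟨s, hs⟩)⟩

lemma map_matchingObj_hom_ext [HasLimits C] {E : Type*} [Category* E] (H : C ⥤ E)
    [PreservesFiniteLimits H] {I : Type v} [PartialOrder I] (hI : ∀ t : I, (Set.Iic t).Finite)
    {F : Iᵒᵖ ⥤ C} {t : I} {B : E} {f g : B ⟶ H.obj (matchingObj F t)}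
    (h : ∀ s hs, f ≫ H.map (matchingπ F t s hs) = g ≫ H.map (matchingπ F t s hs)) : f = g := by
  have : Fintype {s : I // s < t} := ((hI t).subset (fun _ h ↦ le_of_lt h)).fintype
  exact (isLimitOfPreserves H (limit.isLimit (below F t))).hom_ext fun s ↦ h s.unop.1 s.unop.2

/-- Lifts against a natural transformation between diagrams indexed by a cofinite poset can be
constructed by induction on the index, one relative matching map at a time. Here `T` is a lower set
of indices, and the lifts are taken after applying a functor that preserves finite limits. -/
lemma exists_lift_of_relMatchingMap [HasLimits C] {E : Type*} [Category* E] (H : C ⥤ E)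
    [PreservesFiniteLimits H] {I : Type v} [PartialOrder I] (hI : ∀ t : I, (Set.Iic t).Finite)
    {F G : Iᵒᵖ ⥤ C} (φ : F ⟶ G) {A B : E} (i : A ⟶ B)
    (hi : ∀ t, HasLiftingProperty i (H.map (relMatchingMap φ t))) (T : Set I)
    (hT : IsLowerSet T) (α : ∀ t : T, A ⟶ H.obj (F.obj (op t.1)))
    (hα : ∀ {s t : T} (h : s.1 ≤ t.1), α t ≫ H.map (F.map (homOfLE h).op) = α s)
    (γ : ∀ t : T, B ⟶ H.obj (G.obj (op t.1)))
    (hγ : ∀ {s t : T} (h : s.1 ≤ t.1), γ t ≫ H.map (G.map (homOfLE h).op) = γ s)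
    (w : ∀ t : T, α t ≫ H.map (φ.app (op t.1)) = i ≫ γ t) :
    ∃ l : ∀ t : T, B ⟶ H.obj (F.obj (op t.1)),
      (∀ {s t : T} (h : s.1 ≤ t.1), l t ≫ H.map (F.map (homOfLE h).op) = l s) ∧
      ∀ t : T, i ≫ l t = α t ∧ l t ≫ H.map (φ.app (op t.1)) = γ t := by
  have hwf : WellFoundedLT I := wellFoundedLT_of_cofinite hI
  have hwf' : WellFoundedLT T := inferInstance
  let S : T → Type _ := fun t ↦ {l : B ⟶ H.obj (F.obj (op t.1)) //
    i ≫ l = α t ∧ l ≫ H.map (φ.app (op t.1)) = γ t}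
  let ρ : ∀ {s t : T}, s ≤ t → S t → S s := fun {s t} h l ↦
    ⟨l.1 ≫ H.map (F.map (homOfLE h).op), by rw [← Category.assoc, l.2.1]; exact hα h, by
      rw [Category.assoc, ← Functor.map_comp, φ.naturality, Functor.map_comp, ← Category.assoc,
        l.2.2]
      exact hγ h⟩
  obtain ⟨x, hx⟩ := exists_compatible_family S ρ
    (fun t x ↦ Subtype.ext ((congrArg (x.1 ≫ ·)
      ((congrArg H.map (F.map_id _)).trans (H.map_id _))).trans (Category.comp_id _))) (fun t x hx ↦ by
    obtain ⟨b, hb⟩ := exists_matchingObj_lift H hI F t.1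
      (fun s hs ↦ (x ⟨s, hT hs.le t.2⟩ hs).1)
      (fun r s hr hs ↦ congrArg Subtype.val (hx ⟨r, _⟩ ⟨s, hT hs.le t.2⟩ hr hs))
    have hP := (IsPullback.of_hasPullback (matchingMap φ t.1) (matchingProj G t.1)).map H
    have hbγ : b ≫ H.map (matchingMap φ t.1) = γ t ≫ H.map (matchingProj G t.1) := by
      refine map_matchingObj_hom_ext H hI fun s hs ↦ ?_
      rw [Category.assoc, ← Functor.map_comp, matchingMap_π, Functor.map_comp, ← Category.assoc,
        hb, Category.assoc, ← Functor.map_comp, matchingProj_π]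
      exact (x ⟨s, hT hs.le t.2⟩ hs).2.2.trans (hγ (s := ⟨s, hT hs.le t.2⟩) hs.le).symm
    have hr₁ : H.map (relMatchingMap φ t.1) ≫ H.map (pullback.fst _ _) =
        H.map (matchingProj F t.1) := by
      rw [← Functor.map_comp, relMatchingMap, pullback.lift_fst]
    have hr₂ : H.map (relMatchingMap φ t.1) ≫ H.map (pullback.snd _ _) =
        H.map (φ.app (op t.1)) := by
      rw [← Functor.map_comp, relMatchingMap, pullback.lift_snd]
    have := hi t.1
    have sq : CommSq (α t) i (H.map (relMatchingMap φ t.1)) (hP.lift b (γ t) hbγ) := ⟨by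
      refine hP.hom_ext ?_ ?_
      · rw [Category.assoc, hr₁, Category.assoc, hP.lift_fst]
        refine map_matchingObj_hom_ext H hI fun s hs ↦ ?_
        rw [Category.assoc, ← Functor.map_comp, matchingProj_π, Category.assoc, hb]
        exact (hα (s := ⟨s, hT hs.le t.2⟩) hs.le).trans (x ⟨s, hT hs.le t.2⟩ hs).2.1.symm
      · rw [Category.assoc, hr₂, Category.assoc, hP.lift_snd, w]⟩
    refine ⟨⟨sq.lift, sq.fac_left, ?_⟩, fun s hs ↦ Subtype.ext ?_⟩
    · rw [← hr₂, ← Category.assoc, sq.fac_right, hP.lift_snd]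
    · change sq.lift ≫ H.map (F.map (homOfLE hs.le).op) = (x s hs).1
      have e : H.map (matchingProj F t.1) ≫ H.map (matchingπ F t.1 s.1 hs) =
          H.map (F.map (homOfLE (le_of_lt hs)).op) := by
        rw [← Functor.map_comp, matchingProj_π]
        rfl
      refine (congrArg (sq.lift ≫ ·) e.symm).trans ?_
      rw [← hr₁, ← Category.assoc, ← Category.assoc, sq.fac_right, hP.lift_fst, hb])
  exact ⟨fun t ↦ (x t).1, fun h ↦ congrArg Subtype.val (hx h), fun t ↦ (x t).2⟩

/-- Essentially levelwise `L`-maps have the left lifting property with respect to the special maps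
of the class of maps against which `L` lifts. -/
lemma FactorsThrough.hasLiftingProperty_special [HasLimits C] {L : MorphismProperty C}
    {A B : ProObject C} {i : A ⟶ B} (hi : FactorsThrough L i) {X Y : ProObject C} {p : X ⟶ Y}
    (hp : special L.rlp p) : HasLiftingProperty i p := by
  have := preservesFiniteLimits_constant (C := C)
  obtain ⟨I, _, _, _, F, G, φ, hI, ⟨e, e', he⟩, hφ⟩ := hp
  have key : HasLiftingProperty i (levelMap φ) := by
    constructor
    intro f g sq
    obtain ⟨l, hl, hl'⟩ := exists_lift_of_relMatchingMap (constant (C := C)) hI φ i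
      (fun t ↦ hi.hasLiftingProperty_constant (hφ t)) Set.univ isLowerSet_univ
      (fun t ↦ f ≫ (ProObject.mk Iᵒᵖ F).proj (op t.1))
      (fun {s t} h ↦ (Category.assoc _ _ _).trans
        (congrArg (f ≫ ·) ((ProObject.mk Iᵒᵖ F).proj_map (homOfLE h).op)))
      (fun t ↦ g ≫ (ProObject.mk Iᵒᵖ G).proj (op t.1))
      (fun {s t} h ↦ (Category.assoc _ _ _).trans
        (congrArg (g ≫ ·) ((ProObject.mk Iᵒᵖ G).proj_map (homOfLE h).op)))
      (fun t ↦ by rw [Category.assoc, ← levelMap_proj, ← Category.assoc, sq.w, Category.assoc])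
    obtain ⟨k, hk⟩ := exists_lift (ProObject.mk Iᵒᵖ F) (fun t ↦ l ⟨t.unop, trivial⟩)
      (fun {s s'} a ↦ hl (s := ⟨s'.unop, trivial⟩) (t := ⟨s.unop, trivial⟩) (leOfHom a.unop))
    refine ⟨⟨⟨k, hom_ext_proj fun t ↦ ?_, hom_ext_proj fun t ↦ ?_⟩⟩⟩
    · rw [Category.assoc, hk]
      exact (hl' ⟨t.unop, trivial⟩).1
    · rw [Category.assoc, levelMap_proj, ← Category.assoc, hk]
      exact (hl' ⟨t.unop, trivial⟩).2
  have ε : Arrow.mk (levelMap φ) ≅ Arrow.mk p := (Arrow.isoMk e e' he.symm).symm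
  exact HasLiftingProperty.of_arrow_iso_right i ε

/-- A special map is levelwise in the class `L.rlp` of its relative matching maps. -/
lemma essentiallyLevelwise_of_special [HasLimits C] {L : MorphismProperty C}
    {X Y : ProObject C} {p : X ⟶ Y} (hp : special L.rlp p) : essentiallyLevelwise L.rlp p := by
  obtain ⟨I, _, _, _, F, G, φ, hI, h, hφ⟩ := hp
  refine ⟨Iᵒᵖ, _, inferInstance, F, G, φ, h, fun t a b i hi ↦ ⟨fun {f g} sq ↦ ?_⟩⟩
  obtain ⟨l, -, hl⟩ := exists_lift_of_relMatchingMap (𝟭 C) hI φ i (fun s ↦ hφ s i hi)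
    (Set.Iic t.unop) (isLowerSet_Iic _) (fun s ↦ f ≫ F.map (homOfLE s.2).op)
    (fun {s t} h ↦ by
      rw [Functor.id_map, Category.assoc, ← F.map_comp]
      rfl)
    (fun s ↦ g ≫ G.map (homOfLE s.2).op)
    (fun {s t} h ↦ by
      rw [Functor.id_map, Category.assoc, ← G.map_comp]
      rfl)
    (fun s ↦ by
      rw [Functor.id_map, Category.assoc, φ.naturality, ← Category.assoc, sq.w, Category.assoc])
  obtain ⟨h₁, h₂⟩ := hl ⟨t.unop, le_rfl⟩
  refine ⟨⟨⟨l ⟨t.unop, le_rfl⟩, h₁.trans ?_, h₂.trans ?_⟩⟩⟩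
  · exact (congrArg (f ≫ ·) (F.map_id t)).trans (Category.comp_id f)
  · exact (congrArg (g ≫ ·) (G.map_id t)).trans (Category.comp_id g)

/-! ### Factorization on an antichain of indices -/

section Spread

variable [HasLimits C] {I : Type v} [PartialOrder I] (S : Set I)

/-- The diagram `t ↦ ∏ W_s`, the product taken over the indices `s ≤ t` in `S`. A map from a diagram
`F` to it is a family of maps `F_s ⟶ W_s` for `s ∈ S`, see `spreadLift`. -/
def spread (W : I → C) : Iᵒᵖ ⥤ C where
  obj t := ∏ᶜ fun s : {s : I // s ≤ t.unop ∧ s ∈ S} ↦ W s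
  map {t t'} a := Pi.lift fun s ↦
    Pi.π (fun s : {s : I // s ≤ t.unop ∧ s ∈ S} ↦ W s) ⟨s, s.2.1.trans (leOfHom a.unop), s.2.2⟩
  map_id t := Pi.hom_ext _ _ fun s ↦ by simp
  map_comp {t t' t''} a b := Pi.hom_ext _ _ fun s ↦ by simp

/-- The projection of the diagram `spread S W` at `t` to the factor `W_s`. -/
def spreadπ (W : I → C) {s t : I} (h : s ≤ t) (hs : s ∈ S) : (spread S W).obj (op t) ⟶ W s :=
  Pi.π (fun s : {s : I // s ≤ t ∧ s ∈ S} ↦ W s) ⟨s, h, hs⟩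

variable {S}

lemma spread_hom_ext {W : I → C} {t : I} {B : C} {f g : B ⟶ (spread S W).obj (op t)}
    (w : ∀ (s : I) (h : s ≤ t) (hs : s ∈ S), f ≫ spreadπ S W h hs = g ≫ spreadπ S W h hs) :
    f = g :=
  Pi.hom_ext _ _ fun s ↦ w s.1 s.2.1 s.2.2

lemma spread_map_π (W : I → C) {r s t : I} (h : s ≤ t) (h' : r ≤ s) (hr : r ∈ S) :
    (spread S W).map (homOfLE h).op ≫ spreadπ S W h' hr = spreadπ S W (h'.trans h) hr :=
  limit.lift_π _ _

/-- The map to `spread S W` given by maps `F_s ⟶ W_s`. -/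
def spreadLift {F : Iᵒᵖ ⥤ C} {W : I → C} (g : ∀ s, F.obj (op s) ⟶ W s) : F ⟶ spread S W where
  app t := Pi.lift fun s ↦ F.map (homOfLE s.2.1).op ≫ g s
  naturality t t' a := Pi.hom_ext _ _ fun s ↦ by
    simp only [spread, Category.assoc, Pi.lift_π, ← Functor.map_comp_assoc]
    rfl

lemma spreadLift_π {F : Iᵒᵖ ⥤ C} {W : I → C} (g : ∀ s, F.obj (op s) ⟶ W s) {s t : I} (h : s ≤ t)
    (hs : s ∈ S) :
    (spreadLift g).app (op t) ≫ spreadπ S W h hs = F.map (homOfLE h).op ≫ g s :=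
  limit.lift_π _ _

/-- If `s` is the only element of `S` below `s`, then the diagram `spread S W` has value `W_s` at
`s`. -/
lemma isIso_spreadπ (hS : IsAntichain (· ≤ ·) S) (W : I → C) {s : I} (hs : s ∈ S) :
    IsIso (spreadπ S W (le_refl s) hs) := by
  have h : ∀ r : {r : I // r ≤ s ∧ r ∈ S}, r = ⟨s, le_rfl, hs⟩ := fun r ↦
    Subtype.ext (hS.eq r.2.2 hs r.2.1)
  refine ⟨Pi.lift fun r ↦ eqToHom (by rw [h r]), ?_, ?_⟩
  · refine Pi.hom_ext _ _ fun r ↦ ?_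
    obtain rfl := h r
    refine (Category.assoc _ _ _).trans ?_
    refine ((congrArg (spreadπ S W (le_refl s) hs ≫ ·) (limit.lift_π _ _)).trans ?_).trans
      (Category.id_comp _).symm
    exact Category.comp_id _
  · exact (limit.lift_π _ _).trans (by simp)

/-- A map of diagrams `X.hom : F ⟶ X` can be improved at the indices of an antichain `S`: it factors
through a diagram `X' ⟶ X` whose value at `t` is determined by `X_t` and by the `X'_s` with `s ≤ t`
in `S`, where the maps `F_s ⟶ X'_s ⟶ X_s` are factorizations as `L` followed by `R`. -/
lemma exists_factorization_on_antichain (L R : MorphismProperty C) [L.RespectsIso] [R.RespectsIso]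
    [L.HasFactorization R] {F : Iᵒᵖ ⥤ C} (hS : IsAntichain (· ≤ ·) S) (X : Under F) :
    ∃ (X' : Under F) (q : X' ⟶ X),
      (∀ s ∈ S, L (X'.hom.app (op s)) ∧ R (q.right.app (op s))) ∧
      ∀ (t : I) (B : C) (z : B ⟶ X.right.obj (op t))
        (y : ∀ s, s ≤ t → s ∈ S → (B ⟶ X'.right.obj (op s))),
        (∀ s h hs, y s h hs ≫ q.right.app (op s) = z ≫ X.right.map (homOfLE h).op) →
        ∃! y' : B ⟶ X'.right.obj (op t), y' ≫ q.right.app (op t) = z ∧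
          ∀ s h hs, y' ≫ X'.right.map (homOfLE h).op = y s h hs := by
  let Φ (s : I) := MorphismProperty.factorizationData L R (X.hom.app (op s))
  let α : X.right ⟶ spread S (fun s ↦ X.right.obj (op s)) := spreadLift fun s ↦ 𝟙 _
  let β : spread S (fun s ↦ (Φ s).Z) ⟶ spread S (fun s ↦ X.right.obj (op s)) :=
    { app := fun t ↦ Pi.lift fun s ↦ Pi.π (fun s : {s : I // s ≤ t.unop ∧ s ∈ S} ↦ (Φ s).Z) s ≫
        (Φ s).p
      naturality := fun t t' a ↦ Pi.hom_ext _ _ fun s ↦ by simp [spread] }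
  have hα : ∀ {s t : I} (h : s ≤ t) (hs : s ∈ S),
      α.app (op t) ≫ spreadπ S _ h hs = X.right.map (homOfLE h).op := fun h hs ↦ by
    rw [spreadLift_π, Category.comp_id]
  have hβ : ∀ {s t : I} (h : s ≤ t) (hs : s ∈ S),
      β.app (op t) ≫ spreadπ S _ h hs = spreadπ S _ h hs ≫ (Φ s).p := fun h hs ↦
    limit.lift_π _ _
  have hαβ : X.hom ≫ α = spreadLift (fun s ↦ (Φ s).i) ≫ β := by
    ext t
    refine spread_hom_ext (t := t.unop) fun s h hs ↦ ?_
    simp only [NatTrans.comp_app, Category.assoc]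
    rw [hα h hs, hβ h hs, ← Category.assoc]
    refine Eq.trans ?_ (congrArg (· ≫ (Φ s).p) (spreadLift_π _ h hs)).symm
    rw [Category.assoc, (Φ s).fac, X.hom.naturality]
  have hP (t : I) := (IsPullback.of_hasPullback α β).map ((evaluation Iᵒᵖ C).obj (op t))
  -- the map from `X'_t` to the middle object of the factorization at `s`
  let c {s t : I} (h : s ≤ t) (hs : s ∈ S) : (pullback α β).obj (op t) ⟶ (Φ s).Z :=
    (pullback.snd α β).app (op t) ≫ spreadπ S _ h hs
  have hc : ∀ {r s t : I} (h : s ≤ t) (h' : r ≤ s) (hr : r ∈ S),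
      (pullback α β).map (homOfLE h).op ≫ c h' hr = c (h'.trans h) hr := fun h h' hr ↦ by
    rw [← Category.assoc, (pullback.snd α β).naturality, Category.assoc, spread_map_π]
  have hcp : ∀ {s t : I} (h : s ≤ t) (hs : s ∈ S), c h hs ≫ (Φ s).p =
      (pullback.fst α β).app (op t) ≫ X.right.map (homOfLE h).op := fun {s t} h hs ↦ by
    have := NatTrans.congr_app (pullback.condition (f := α) (g := β)) (op t)
    rw [NatTrans.comp_app, NatTrans.comp_app] at this
    rw [← hα h hs, ← Category.assoc, this, Category.assoc, Category.assoc, hβ]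
  have hcp' : ∀ {s : I} (hs : s ∈ S),
      c (le_refl s) hs ≫ (Φ s).p = (pullback.fst α β).app (op s) := fun hs ↦
    (hcp _ hs).trans ((congrArg (_ ≫ ·) (X.right.map_id _)).trans (Category.comp_id _))
  have hci : ∀ {s : I} (hs : s ∈ S), IsIso (c (le_refl s) hs) := fun {s} hs ↦ by
    have h₁ := isIso_spreadπ hS (fun s ↦ X.right.obj (op s)) hs
    have h₂ := isIso_spreadπ hS (fun s ↦ (Φ s).Z) hs
    have h₃ : α.app (op s) ≫ spreadπ S _ le_rfl hs = 𝟙 _ :=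
      (hα le_rfl hs).trans (X.right.map_id _)
    have h₄ : IsIso (α.app (op s) ≫ spreadπ S _ le_rfl hs) := by
      rw [h₃]
      infer_instance
    have h₅ : IsIso (((evaluation Iᵒᵖ C).obj (op s)).map α) :=
      IsIso.of_isIso_comp_right (α.app (op s)) (spreadπ S _ le_rfl hs)
    have h₆ : IsIso ((pullback.snd α β).app (op s)) := (hP s).isIso_snd_of_isIso
    infer_instance
  let ι : F ⟶ pullback α β := pullback.lift X.hom (spreadLift fun s ↦ (Φ s).i) hαβ
  refine ⟨Under.mk ι, Under.homMk (pullback.fst α β) (pullback.lift_fst _ _ _), fun s hs ↦ ⟨?_, ?_⟩,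
    fun t B z y hy ↦ ?_⟩
  · have := hci hs
    have e : ι.app (op s) ≫ c le_rfl hs = (Φ s).i := by
      rw [← Category.assoc, ← NatTrans.comp_app, pullback.lift_snd, spreadLift_π]
      exact (congrArg (· ≫ _) (F.map_id _)).trans (Category.id_comp _)
    refine (L.cancel_right_of_respectsIso (ι.app (op s)) (c le_rfl hs)).1 ?_
    rw [e]
    exact (Φ s).hi
  · have := hci hs
    change R ((pullback.fst α β).app (op s))
    rw [← hcp' hs, R.cancel_left_of_respectsIso]
    exact (Φ s).hp
  · let v : B ⟶ (spread S fun s ↦ (Φ s).Z).obj (op t) :=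
      Pi.lift fun s : {s : I // s ≤ t ∧ s ∈ S} ↦ y s.1 s.2.1 s.2.2 ≫ c le_rfl s.2.2
    have hv : ∀ s h hs, v ≫ spreadπ S _ h hs = y s h hs ≫ c le_rfl hs := fun s h hs ↦
      limit.lift_π _ _
    have hy' : z ≫ α.app (op t) = v ≫ β.app (op t) := by
      refine spread_hom_ext fun s h hs ↦ ?_
      rw [Category.assoc, hα h hs, Category.assoc, hβ h hs, ← Category.assoc, hv]
      exact (hy s h hs).symm.trans ((congrArg (y s h hs ≫ ·) (hcp' hs).symm).trans
        (Category.assoc _ _ _).symm)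
    refine ⟨(hP t).lift z v hy', ⟨(hP t).lift_fst _ _ _, fun s h hs ↦ ?_⟩, ?_⟩
    · have := hci hs
      refine (cancel_mono (c le_rfl hs)).1 ?_
      refine ((Category.assoc _ _ _).trans (congrArg (_ ≫ ·) (hc h le_rfl hs))).trans ?_
      exact (Category.assoc _ _ _).symm.trans
        ((congrArg (· ≫ _) ((hP t).lift_snd _ _ _)).trans (hv s h hs))
    · rintro y' ⟨h₁, h₂⟩
      refine (hP t).hom_ext (h₁.trans ((hP t).lift_fst _ _ _).symm) ?_
      refine Eq.trans (b := v) ?_ ((hP t).lift_snd _ _ _).symm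
      change y' ≫ (pullback.snd α β).app (op t) = v
      refine spread_hom_ext fun s h hs ↦ ?_
      refine Eq.trans ?_ (hv s h hs).symm
      refine (Category.assoc _ _ _).trans ((congrArg (y' ≫ ·) (hc h le_rfl hs).symm).trans ?_)
      exact (Category.assoc _ _ _).symm.trans (congrArg (· ≫ _) (h₂ s h hs))

end Spread

/-! ### Towers of factorizations -/

section Tower

variable {I : Type v} [PartialOrder I] (T : ℕᵒᵖ ⥤ Iᵒᵖ ⥤ C)

/-- The transition maps of a tower of diagrams, in both directions at once. -/
def towerMap {j k : ℕ} (h : j ≤ k) {s t : I} (h' : s ≤ t) :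
    (T.obj (op k)).obj (op t) ⟶ (T.obj (op j)).obj (op s) :=
  (T.map (homOfLE h).op).app (op t) ≫ (T.obj (op j)).map (homOfLE h').op

lemma towerMap_self (k : ℕ) (t : I) : towerMap T (le_refl k) (le_refl t) = 𝟙 _ := by
  have h₁ : (T.map (homOfLE (le_refl k)).op).app (op t) = 𝟙 _ :=
    (congrArg (fun x : T.obj (op k) ⟶ T.obj (op k) ↦ x.app (op t)) (T.map_id (op k)) :)
  have h₂ : (T.obj (op k)).map (homOfLE (le_refl t)).op = 𝟙 _ := (T.obj (op k)).map_id _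
  rw [towerMap, h₁, h₂, Category.comp_id]

lemma towerMap_comp {i j k : ℕ} (h₁ : i ≤ j) (h₂ : j ≤ k) {r s t : I} (h₁' : r ≤ s) (h₂' : s ≤ t) :
    towerMap T h₂ h₂' ≫ towerMap T h₁ h₁' = towerMap T (h₁.trans h₂) (h₁'.trans h₂') := by
  have e₁ : (T.map (homOfLE (h₁.trans h₂)).op).app (op t) =
      (T.map (homOfLE h₂).op).app (op t) ≫ (T.map (homOfLE h₁).op).app (op t) := by
    rw [← NatTrans.comp_app, ← T.map_comp]
    rfl
  have e₂ : (T.obj (op i)).map (homOfLE (h₁'.trans h₂')).op =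
      (T.obj (op i)).map (homOfLE h₂').op ≫ (T.obj (op i)).map (homOfLE h₁').op := by
    rw [← Functor.map_comp]
    rfl
  rw [towerMap, towerMap, towerMap, e₁, e₂, Category.assoc, Category.assoc,
    NatTrans.naturality_assoc]

lemma towerMap_refl_left (k : ℕ) {s t : I} (h : s ≤ t) :
    towerMap T (le_refl k) h = (T.obj (op k)).map (homOfLE h).op := by
  refine (congrArg (· ≫ _) ?_).trans (Category.id_comp _)
  exact (congrArg (fun x : T.obj (op k) ⟶ T.obj (op k) ↦ x.app (op t)) (T.map_id (op k)) :)

lemma towerMap_refl_right {j k : ℕ} (h : j ≤ k) (t : I) :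
    towerMap T h (le_refl t) = (T.map (homOfLE h).op).app (op t) :=
  (congrArg (_ ≫ ·) ((T.obj (op j)).map_id (op t))).trans (Category.comp_id _)

/-- In the tower `T`, the stage `k + 1` is obtained from the stage `k` by modifying it at the indices
of rank `k`: its value at `t` is determined by the value of the stage `k` at `t` and by its own
values at the indices `s ≤ t` of rank `k`. -/
def IsRankTower (rk : I → ℕ) : Prop :=
  ∀ (k : ℕ) (t : I) (B : C) (z : B ⟶ (T.obj (op k)).obj (op t))
    (y : ∀ s, s ≤ t → rk s = k → (B ⟶ (T.obj (op (k + 1))).obj (op s))),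
    (∀ s h hs, y s h hs ≫ towerMap T k.le_succ (le_refl s) = z ≫ towerMap T (le_refl k) h) →
    ∃! y' : B ⟶ (T.obj (op (k + 1))).obj (op t), y' ≫ towerMap T k.le_succ (le_refl t) = z ∧
      ∀ s h hs, y' ≫ towerMap T (le_refl (k + 1)) h = y s h hs

variable {T} {rk : I → ℕ}

/-- A map to the stage `k` at `t` is determined by the induced maps to the bottom stage at `t` and to
the values at the indices `s ≤ t` of rank less than `k` of the first stages modified there. -/
lemma IsRankTower.hom_ext (hT : IsRankTower T rk) {k : ℕ} {t : I} {B : C}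
    {f g : B ⟶ (T.obj (op k)).obj (op t)}
    (h₀ : f ≫ towerMap T k.zero_le (le_refl t) = g ≫ towerMap T k.zero_le (le_refl t))
    (h : ∀ (s : I) (hs : s ≤ t) (hk : rk s < k),
      f ≫ towerMap T (Nat.succ_le_of_lt hk) hs = g ≫ towerMap T (Nat.succ_le_of_lt hk) hs) :
    f = g := by
  induction k with
  | zero => simpa only [towerMap_self, Category.comp_id] using h₀
  | succ k ih =>
    obtain ⟨y, -, hy⟩ := hT k t B (f ≫ towerMap T k.le_succ (le_refl t))
      (fun s hs _ ↦ f ≫ towerMap T (le_refl _) hs) (fun s hs hk ↦ by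
        simp only [Category.assoc, towerMap_comp])
    refine (hy f ⟨rfl, fun _ _ _ ↦ rfl⟩).trans (hy g ⟨(ih ?_ fun s hs hk ↦ ?_).symm,
      fun s hs hk ↦ ?_⟩).symm
    · simpa only [Category.assoc, towerMap_comp] using h₀
    · simpa only [Category.assoc, towerMap_comp] using h s hs (hk.trans k.lt_succ_self)
    · have := congrArg (· ≫ towerMap T (by omega : k + 1 ≤ rk s + 1) (le_refl s))
        (h s hs (by omega))
      simpa only [Category.assoc, towerMap_comp] using this.symm

/-- Let a lift be prescribed at all indices below `t`, compatibly, and at `t` in the bottom stage.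
Since the indices below `t` have smaller rank, this data determines a map to the stage `rk t` at `t`,
for any `i`; it then remains to lift `i` against the map to that stage from the next one. -/
lemma IsRankTower.exists_lift (hT : IsRankTower T rk) (hrk : StrictMono rk) {A B : C} (i : A ⟶ B)
    (t : I) (hi : HasLiftingProperty i (towerMap T (rk t).le_succ (le_refl t)))
    (α : A ⟶ (T.obj (op (rk t + 1))).obj (op t)) (γ : B ⟶ (T.obj (op 0)).obj (op t))
    (β : ∀ s, s < t → (B ⟶ (T.obj (op (rk s + 1))).obj (op s)))
    (hβ : ∀ (r s : I) (hr : r ≤ s) (hs : s < t),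
      β s hs ≫ towerMap T (Nat.succ_le_succ (hrk.monotone hr)) hr = β r (hr.trans_lt hs))
    (hβγ : ∀ (s : I) (hs : s < t), β s hs ≫ towerMap T (Nat.zero_le _) (le_refl s) =
      γ ≫ towerMap T (le_refl 0) hs.le)
    (hα : ∀ (s : I) (hs : s < t),
      i ≫ β s hs = α ≫ towerMap T (Nat.succ_le_succ (hrk.monotone hs.le)) hs.le)
    (hαγ : i ≫ γ = α ≫ towerMap T (Nat.zero_le _) (le_refl t)) :
    ∃ l : B ⟶ (T.obj (op (rk t + 1))).obj (op t), i ≫ l = α ∧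
      l ≫ towerMap T (Nat.zero_le _) (le_refl t) = γ ∧
      ∀ (s : I) (hs : s < t),
        l ≫ towerMap T (Nat.succ_le_succ (hrk.monotone hs.le)) hs.le = β s hs := by
  have key : ∀ (k : ℕ) (hk : k ≤ rk t), ∃ z : B ⟶ (T.obj (op k)).obj (op t),
      i ≫ z = α ≫ towerMap T (hk.trans (Nat.le_succ _)) (le_refl t) ∧
      z ≫ towerMap T (Nat.zero_le _) (le_refl t) = γ ∧
      ∀ (s : I) (hs : s < t) (hk' : rk s < k),
        z ≫ towerMap T (Nat.succ_le_of_lt hk') hs.le = β s hs := by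
    intro k
    induction k with
    | zero =>
      exact fun _ ↦ ⟨γ, hαγ, by rw [towerMap_self, Category.comp_id], fun s _ h ↦
        absurd h (Nat.not_lt_zero _)⟩
    | succ k ih =>
      intro hk
      obtain ⟨z, hz₁, hz₂, hz₃⟩ := ih (Nat.le_of_succ_le hk)
      have hlt : ∀ s : I, s ≤ t → rk s = k → s < t := fun s h hs ↦
        lt_of_le_of_ne h fun e ↦ by subst e; omega
      obtain ⟨y, ⟨hy₁, hy₂⟩, -⟩ := hT k t B z
        (fun s h hs ↦ β s (hlt s h hs) ≫ towerMap T (by omega) (le_refl s)) (fun s h hs ↦ by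
          refine hT.hom_ext ?_ fun r hr hk ↦ ?_
          · simp only [Category.assoc, towerMap_comp]
            rw [hβγ, ← hz₂, Category.assoc, towerMap_comp]
          · simp only [Category.assoc, towerMap_comp]
            rw [hβ, hz₃ r (hr.trans_lt (hlt s h hs)) hk])
      refine ⟨y, hT.hom_ext ?_ fun s h hk' ↦ ?_, ?_, fun s hs hk' ↦ ?_⟩
      · rw [Category.assoc, Category.assoc, towerMap_comp,
          ← towerMap_comp T (Nat.zero_le k) k.le_succ (le_refl t) (le_refl t), ← Category.assoc y,
          hy₁, hz₂, hαγ]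
      · have hs : s < t := lt_of_le_of_ne h fun e ↦ by subst e; omega
        rw [Category.assoc, Category.assoc, towerMap_comp, ← hα s hs]
        congr 1
        rcases Nat.lt_succ_iff_lt_or_eq.1 hk' with hk' | hk'
        · rw [← towerMap_comp T (Nat.succ_le_of_lt hk') k.le_succ h (le_refl t), ← Category.assoc,
            hy₁, hz₃ s hs hk']
        · rw [← towerMap_comp T (by omega) (le_refl (k + 1)) (le_refl s) h, ← Category.assoc,
            hy₂ s h hk', Category.assoc, towerMap_comp, towerMap_self, Category.comp_id]
      · rw [← towerMap_comp T (Nat.zero_le k) k.le_succ (le_refl t) (le_refl t), ← Category.assoc,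
          hy₁, hz₂]
      · rcases Nat.lt_succ_iff_lt_or_eq.1 hk' with hk' | hk'
        · rw [← towerMap_comp T (Nat.succ_le_of_lt hk') k.le_succ hs.le (le_refl t),
            ← Category.assoc, hy₁, hz₃ s hs hk']
        · rw [← towerMap_comp T (by omega) (le_refl (k + 1)) (le_refl s) hs.le, ← Category.assoc,
            hy₂ s hs.le hk', Category.assoc, towerMap_comp, towerMap_self, Category.comp_id]
  obtain ⟨z, hz₁, hz₂, hz₃⟩ := key (rk t) le_rfl
  have sq : CommSq α i (towerMap T (rk t).le_succ (le_refl t)) z := ⟨hz₁.symm⟩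
  obtain ⟨l, hl, hl'⟩ : ∃ l, i ≫ l = α ∧ l ≫ towerMap T (rk t).le_succ (le_refl t) = z :=
    ⟨sq.lift, sq.fac_left, sq.fac_right⟩
  refine ⟨l, hl, ?_, fun s hs ↦ ?_⟩
  · rw [← hz₂, ← hl', Category.assoc, towerMap_comp]
  · rw [← hz₃ s hs (hrk hs), ← hl', Category.assoc, towerMap_comp]

variable (T)

/-- The diagram whose value at `t` is that of stage `rk t + 1` of the tower. When `IsRankTower T rk`
holds, the later stages have the same value at `t`, so that this is the limit of the tower. -/
def towerDiagonal (hrk : StrictMono rk) : Iᵒᵖ ⥤ C where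
  obj t := (T.obj (op (rk t.unop + 1))).obj t
  map a := towerMap T (Nat.succ_le_succ (hrk.monotone (leOfHom a.unop))) (leOfHom a.unop)
  map_id _ := towerMap_self T _ _
  map_comp _ _ := (towerMap_comp T _ _ _ _).symm

/-- The projection of the diagonal of the tower to the bottom stage. -/
def towerDiagonalProj (hrk : StrictMono rk) : towerDiagonal T hrk ⟶ T.obj (op 0) where
  app t := towerMap T (Nat.zero_le _) (le_refl t.unop)
  naturality t t' a := by
    have h : (T.obj (op 0)).map a = towerMap T (le_refl 0) (leOfHom a.unop) :=
      (towerMap_refl_left T 0 _).symm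
    rw [h]
    exact (towerMap_comp T _ _ _ _).trans (towerMap_comp T _ _ _ _).symm

variable {T}

/-- The relative matching map at `t` of the projection from the diagonal has the lifting properties of
the map from the stage `rk t + 1` to the stage `rk t` at `t`. -/
lemma IsRankTower.rlp_relMatchingMap [HasLimits C] (hT : IsRankTower T rk) (hrk : StrictMono rk)
    {L : MorphismProperty C} {t : I} (hL : L.rlp (towerMap T (rk t).le_succ (le_refl t))) :
    L.rlp (relMatchingMap (towerDiagonalProj T hrk) t) := by
  intro A B i hi
  constructor
  intro α β sq
  have h₁ : relMatchingMap (towerDiagonalProj T hrk) t ≫ pullback.fst _ _ = matchingProj _ t :=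
    pullback.lift_fst _ _ _
  have h₂ : relMatchingMap (towerDiagonalProj T hrk) t ≫ pullback.snd _ _ =
      (towerDiagonalProj T hrk).app (op t) := pullback.lift_snd _ _ _
  have hγ : ∀ s (hs : s < t), (β ≫ pullback.fst _ _ ≫ matchingπ _ t s hs) ≫
      (towerDiagonalProj T hrk).app (op s) = (β ≫ pullback.snd _ _) ≫
        (T.obj (op 0)).map (homOfLE hs.le).op := fun s hs ↦ by
    rw [Category.assoc, Category.assoc, ← matchingMap_π, pullback.condition_assoc, matchingProj_π,
      Category.assoc]
  obtain ⟨l, hl₁, hl₂, hl₃⟩ := hT.exists_lift hrk i t (hL i hi) α (β ≫ pullback.snd _ _)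
    (fun s hs ↦ β ≫ pullback.fst _ _ ≫ matchingπ _ t s hs)
    (fun r s hr hs ↦ by
      have : matchingπ (towerDiagonal T hrk) t s hs ≫
          (towerDiagonal T hrk).map (homOfLE hr).op = matchingπ _ t r (hr.trans_lt hs) :=
        limit.w (below (towerDiagonal T hrk) t)
          (j := op ⟨s, hs⟩) (j' := op ⟨r, hr.trans_lt hs⟩) (homOfLE hr).op
      refine (Category.assoc _ _ _).trans (congrArg (β ≫ ·) ?_)
      exact (Category.assoc _ _ _).trans (congrArg (_ ≫ ·) this))
    (fun s hs ↦ (hγ s hs).trans (congrArg (_ ≫ ·) (towerMap_refl_left T 0 hs.le).symm))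
    (fun s hs ↦ by
      refine (Category.assoc _ _ _).symm.trans ((congrArg (· ≫ _) sq.w.symm).trans ?_)
      refine (Category.assoc _ _ _).trans (congrArg (α ≫ ·) ?_)
      exact (Category.assoc _ _ _).symm.trans
        ((congrArg (· ≫ _) h₁).trans (matchingProj_π _ _ _ hs)))
    (by
      rw [← Category.assoc, ← sq.w, Category.assoc, h₂]
      rfl)
  refine ⟨⟨⟨l, hl₁, pullback.hom_ext ?_ ?_⟩⟩⟩
  · refine matchingObj_hom_ext fun s hs ↦ ?_
    refine Eq.trans ?_ ((hl₃ s hs).trans (Category.assoc _ _ _).symm)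
    refine (congrArg (· ≫ _) ((Category.assoc _ _ _).trans (congrArg (l ≫ ·) h₁))).trans ?_
    exact (Category.assoc _ _ _).trans (congrArg (l ≫ ·) (matchingProj_π _ _ _ hs))
  · exact (Category.assoc _ _ _).trans ((congrArg (l ≫ ·) h₂).trans hl₂)

/-- Iterating the factorization on the antichains of indices of a given rank yields a tower of
diagrams under `F` that starts with the given map `f`. -/
lemma exists_isRankTower [HasLimits C] (L R : MorphismProperty C) [L.RespectsIso] [R.RespectsIso]
    [L.HasFactorization R] {F G : Iᵒᵖ ⥤ C} (f : F ⟶ G) (hrk : StrictMono rk) :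
    ∃ (T : ℕᵒᵖ ⥤ Iᵒᵖ ⥤ C) (ι : ∀ k, F ⟶ T.obj (op k)) (e : T.obj (op 0) ≅ G),
      ι 0 ≫ e.hom = f ∧ (∀ {j k : ℕ} (h : j ≤ k), ι k ≫ T.map (homOfLE h).op = ι j) ∧
      IsRankTower T rk ∧
      ∀ t, L ((ι (rk t + 1)).app (op t)) ∧ R (towerMap T (rk t).le_succ (le_refl t)) := by
  have hS : ∀ k, IsAntichain (· ≤ ·) {t | rk t = k} := fun k s hs t ht hne h ↦
    (hrk (lt_of_le_of_ne h hne)).ne (hs.trans ht.symm)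
  choose X' q hq hq' using fun k ↦ exists_factorization_on_antichain L R (F := F) (hS k)
  let X : ℕ → Under F := fun n ↦ Nat.rec (Under.mk f) (fun k Y ↦ X' k Y) n
  let T' : ℕᵒᵖ ⥤ Under F := Functor.ofOpSequence (X := X) fun k ↦ q k (X k)
  let T : ℕᵒᵖ ⥤ Iᵒᵖ ⥤ C := T' ⋙ Under.forget F
  have hT : ∀ k, T.map (homOfLE k.le_succ).op = (q k (X k)).right := fun k ↦
    congrArg (fun x : X (k + 1) ⟶ X k ↦ x.right)
      (Functor.ofOpSequence_map_homOfLE_succ (X := X) (fun k ↦ q k (X k)) k)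
  refine ⟨T, fun k ↦ (X k).hom, Iso.refl _, Category.comp_id _, fun h ↦ Under.w _, ?_,
    fun t ↦ ⟨(hq _ (X (rk t)) t rfl).1, ?_⟩⟩
  · intro k t B z y hy
    simp only [towerMap_refl_left, towerMap_refl_right, hT] at hy ⊢
    exact hq' k (X k) t B z y hy
  · rw [towerMap_refl_right, hT]
    exact (hq _ (X (rk t)) t rfl).2

/-- Every map of diagrams indexed by a cofinite poset factors as a levelwise `L`-map followed by a map
whose relative matching maps have the right lifting property with respect to `L`. -/
lemma exists_factorization_relMatchingMap [HasLimits C] (L : MorphismProperty C) [L.RespectsIso]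
    [L.HasFactorization L.rlp] (hI : ∀ t : I, (Set.Iic t).Finite) {F G : Iᵒᵖ ⥤ C} (f : F ⟶ G) :
    ∃ (Z G' : Iᵒᵖ ⥤ C) (i : F ⟶ Z) (p : Z ⟶ G') (e : G' ≅ G), i ≫ p ≫ e.hom = f ∧
      (∀ t, L (i.app t)) ∧ ∀ t, L.rlp (relMatchingMap p t) := by
  obtain ⟨rk, hrk⟩ := exists_strictMono_nat hI
  obtain ⟨T, ι, e, he, hι, hT, hLR⟩ := exists_isRankTower L L.rlp f hrk
  have hι' : ∀ {j k : ℕ} (h : j ≤ k) (t : I),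
      (ι k).app (op t) ≫ towerMap T h (le_refl t) = (ι j).app (op t) := fun h t ↦ by
    rw [towerMap_refl_right, ← NatTrans.comp_app, hι]
  refine ⟨towerDiagonal T hrk, T.obj (op 0),
    { app := fun t ↦ (ι (rk t.unop + 1)).app t
      naturality := fun t t' a ↦ ?_ },
    towerDiagonalProj T hrk, e, ?_, fun t ↦ (hLR t.unop).1,
    fun t ↦ hT.rlp_relMatchingMap hrk (hLR t).2⟩
  · have h : rk t'.unop + 1 ≤ rk t.unop + 1 := Nat.succ_le_succ (hrk.monotone (leOfHom a.unop))
    change F.map a ≫ _ = (ι (rk t.unop + 1)).app t ≫ towerMap T h (leOfHom a.unop)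
    rw [← towerMap_comp T (le_refl _) h (leOfHom a.unop) (le_refl t.unop), ← Category.assoc]
    refine Eq.trans ?_ (congrArg (· ≫ _) (hι' h t.unop)).symm
    rw [towerMap_refl_left]
    exact (ι _).naturality a
  · rw [← he, ← Category.assoc]
    congr 1
    ext t
    exact hι' (Nat.zero_le _) t.unop

end Tower

/-! ### Factorization of morphisms of pro-objects -/

/-- Every morphism of pro-objects factors as an essentially levelwise `L`-map followed by a special
map of the class of maps having the right lifting property with respect to `L`. -/
lemma exists_special_factorization [HasLimits C] (L : MorphismProperty C) [L.RespectsIso]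
    [L.HasFactorization L.rlp] {X Y : ProObject C} (f : X ⟶ Y) :
    ∃ (Z : ProObject C) (i : X ⟶ Z) (p : Z ⟶ Y),
      essentiallyLevelwise L i ∧ special L.rlp p ∧ i ≫ p = f := by
  obtain ⟨I, _, _, _, F, G, φ, hI, e, e', he⟩ := exists_cofinite_levelRepresentation f
  obtain ⟨Z, G', i, p, ε, hφ, hi, hp⟩ := exists_factorization_relMatchingMap L hI φ
  let ε' : ProObject.mk Iᵒᵖ G' ≅ ProObject.mk Iᵒᵖ G :=
    { hom := levelMap ε.hom
      inv := levelMap ε.inv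
      hom_inv_id := by
        rw [levelMap_comp_eq, ε.hom_inv_id]
        rfl
      inv_hom_id := by
        rw [levelMap_comp_eq, ε.inv_hom_id]
        rfl }
  refine ⟨ProObject.mk Iᵒᵖ Z, e.hom ≫ levelMap i, levelMap p ≫ ε'.hom ≫ e'.inv,
    ⟨Iᵒᵖ, _, inferInstance, F, Z, i, ⟨e, Iso.refl _, Category.comp_id _⟩, hi⟩,
    ⟨I, _, ‹_›, ‹_›, Z, G', p, hI, ⟨Iso.refl _, e' ≪≫ ε'.symm, ?_⟩, hp⟩, ?_⟩
  · simp
  · have h : levelMap i ≫ levelMap p ≫ ε'.hom = levelMap φ := by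
      change levelMap i ≫ levelMap p ≫ levelMap ε.hom = _
      rw [levelMap_comp_eq, levelMap_comp_eq, hφ]
    rw [← cancel_mono e'.hom, he, ← h]
    simp

lemma essentiallyLevelwise_mono {P Q : MorphismProperty C} (h : P ≤ Q) :
    essentiallyLevelwise P ≤ essentiallyLevelwise Q := by
  rintro X Y f ⟨I, _, _, F, G, φ, hf, hφ⟩
  exact ⟨I, _, _, F, G, φ, hf, fun s ↦ h _ (hφ s)⟩

lemma special_mono [HasLimits C] {P Q : MorphismProperty C} (h : P ≤ Q) :
    special P ≤ special Q := by
  rintro X Y f ⟨I, _, _, _, F, G, φ, hI, hf, hφ⟩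
  exact ⟨I, _, ‹_›, ‹_›, F, G, φ, hI, hf, fun t ↦ h _ (hφ t)⟩

/-! ### The strict model structure -/

section ModelStructure

variable [HasLimits C] [ModelCategory C]

/-- Right properness needs only that strict fibrations are essentially levelwise fibrations. -/
lemma essentiallyLevelwise_fibrations_of_strictFibrations {X Y : ProObject C} {p : X ⟶ Y}
    (hp : strictFibrations C p) : essentiallyLevelwise (fibrations C) p := by
  refine MorphismProperty.retracts_le_iff.2 (fun X Y p hp ↦ ?_) p hp
  rw [specialFibrations, ← MorphismProperty.rlp_eq_of_wfs (trivialCofibrations C) (fibrations C)]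
    at hp
  have := essentiallyLevelwise_of_special hp
  rwa [MorphismProperty.rlp_eq_of_wfs (trivialCofibrations C) (fibrations C)] at this

lemma isStableUnderRetracts_strictFibrations :
    (strictFibrations C).IsStableUnderRetracts where
  of_retract h := fun ⟨_, _, g, h', hg⟩ ↦ ⟨_, _, g, Retract.trans h h', hg⟩

lemma hasLiftingProperty_strictFibrations {A B X Y : ProObject C} {i : A ⟶ B} {p : X ⟶ Y}
    (hi : strictCofibrations C i) (hi' : strictWeakEquivalences C i)
    (hp : strictFibrations C p) : HasLiftingProperty i p := by
  obtain ⟨_, _, q, h, hq⟩ := hp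
  rw [specialFibrations, ← MorphismProperty.rlp_eq_of_wfs (trivialCofibrations C) (fibrations C)]
    at hq
  have := FactorsThrough.hasLiftingProperty_special (factorsThrough_trivialCofibrations
    (factorsThrough_of_essentiallyLevelwise hi) (factorsThrough_of_essentiallyLevelwise hi')) hq
  exact h.rightLiftingProperty i

lemma exists_factorization_trivialCofibrations {X Y : ProObject C} (f : X ⟶ Y) :
    ∃ (Z : ProObject C) (i : X ⟶ Z) (p : Z ⟶ Y), strictCofibrations C i ∧
      strictWeakEquivalences C i ∧ strictFibrations C p ∧ i ≫ p = f := by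
  have h := MorphismProperty.rlp_eq_of_wfs (trivialCofibrations C) (fibrations C)
  have : (trivialCofibrations C).HasFactorization (trivialCofibrations C).rlp := by
    rw [h]
    infer_instance
  obtain ⟨Z, i, p, hi, hp, e⟩ := exists_special_factorization (trivialCofibrations C) f
  rw [h] at hp
  exact ⟨Z, i, p, essentiallyLevelwise_mono inf_le_left _ hi,
    essentiallyLevelwise_mono inf_le_right _ hi, MorphismProperty.le_retracts _ _ hp, e⟩

/-- Here the second factor is a special acyclic fibration, which lifts against all strict
cofibrations. -/
lemma exists_factorization_trivialFibrations {X Y : ProObject C} (f : X ⟶ Y) :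
    ∃ (Z : ProObject C) (i : X ⟶ Z) (p : Z ⟶ Y), strictCofibrations C i ∧
      strictWeakEquivalences C p ∧ strictFibrations C p ∧
      (strictCofibrations C).rlp p ∧ i ≫ p = f := by
  have h := MorphismProperty.rlp_eq_of_wfs (cofibrations C) (trivialFibrations C)
  have : (cofibrations C).HasFactorization (cofibrations C).rlp := by
    rw [h]
    infer_instance
  obtain ⟨Z, i, p, hi, hp, e⟩ := exists_special_factorization (cofibrations C) f
  refine ⟨Z, i, p, hi, essentiallyLevelwise_mono inf_le_right _
    (h ▸ essentiallyLevelwise_of_special hp), MorphismProperty.le_retracts _ _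
    (special_mono inf_le_left _ (h ▸ hp)), fun A B j hj ↦ ?_, e⟩
  exact FactorsThrough.hasLiftingProperty_special (factorsThrough_of_essentiallyLevelwise hj) hp

/-- An acyclic strict fibration is a retract of a special acyclic fibration: it lifts against the
first factor of its factorization, which is an acyclic strict cofibration. -/
lemma hasLiftingProperty_strictCofibrations (hC : IsProperModelCategory C)
    {A B X Y : ProObject C} {i : A ⟶ B} {p : X ⟶ Y} (hi : strictCofibrations C i)
    (hp : strictFibrations C p) (hp' : strictWeakEquivalences C p) : HasLiftingProperty i p := by
  have := hasTwoOutOfThreeProperty_strictWeakEquivalences hC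
  obtain ⟨Z, j, q, hj, hq, -, hq', e⟩ := exists_factorization_trivialFibrations p
  have hj' := (strictWeakEquivalences C).of_postcomp j q hq (e.symm ▸ hp')
  have := hasLiftingProperty_strictFibrations hj hj' hp
  have := hq' i hi
  exact (RetractArrow.ofRightLiftingProperty e).rightLiftingProperty i

/-- The strict model structure on the pro-category of a proper model category. -/
abbrev strictModelCategory [HasColimits C] (hC : IsProperModelCategory C) :
    ModelCategory (ProObject C) :=
  have := hasLimits_proObject (C := C)
  have := hasColimits_proObject (C := C)
  { categoryWithFibrations := ⟨strictFibrations C⟩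
    categoryWithCofibrations := ⟨strictCofibrations C⟩
    categoryWithWeakEquivalences := ⟨strictWeakEquivalences C⟩
    cm2 := hasTwoOutOfThreeProperty_strictWeakEquivalences hC
    cm3a := isStableUnderRetracts_essentiallyLevelwise (weakEquivalences C)
    cm3b := isStableUnderRetracts_strictFibrations
    cm3c := isStableUnderRetracts_essentiallyLevelwise (cofibrations C)
    cm4a := fun i p h h' h'' ↦ hasLiftingProperty_strictFibrations h.mem h'.mem h''.mem
    cm4b := fun i p h h' h'' ↦ hasLiftingProperty_strictCofibrations hC h.mem h'.mem h''.mem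
    cm5a := ⟨fun f ↦
      have ⟨_, i, p, hi, hi', hp, e⟩ := exists_factorization_trivialCofibrations f
      ⟨⟨_, i, p, e, ⟨hi, hi'⟩, hp⟩⟩⟩
    cm5b := ⟨fun f ↦
      have ⟨_, i, p, hi, hp', hp, _, e⟩ := exists_factorization_trivialFibrations f
      ⟨⟨_, i, p, e, hi, ⟨hp, hp'⟩⟩⟩⟩ }

end ModelStructure

end

end ProObject

theorem mainTheorem1 (C : Type u) [Category.{v} C] [HasLimits C] [HasColimits C]
    [ModelCategory C] (hC : IsProperModelCategory C) :
    HasLimits (ProObject C) ∧ HasColimits (ProObject C) ∧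
    ∃ _ : ModelCategory (ProObject C),
      weakEquivalences (ProObject C) = ProObject.strictWeakEquivalences C ∧
      cofibrations (ProObject C) = ProObject.strictCofibrations C ∧
      fibrations (ProObject C) = ProObject.strictFibrations C ∧
      IsProperModelCategory (ProObject C) :=
  ⟨ProObject.hasLimits_proObject, ProObject.hasColimits_proObject,
    ProObject.strictModelCategory hC, rfl, rfl, rfl,
    letI := ProObject.strictModelCategory hC
    { left := fun sq hi hw ↦ ProObject.strictWeakEquivalences_of_isPushout hC sq hi hw
      right := fun sq hp hw ↦ ProObject.strictWeakEquivalences_of_isPullback hC sq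
        (ProObject.essentiallyLevelwise_fibrations_of_strictFibrations hp) hw }⟩
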